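/- Let $R$ be a principal ideal domain. For a finitely generated $R$-module $L$ write $\operatorname{rank}_R L=\dim_{\mathrm{Frac}(R)}(\mathrm{Frac}(R)\otimes_R L)$. Let $M$ be a matroid on a finite ground set $E$. An $R$-quasi-representation $\rho$ of $M$ in a finitely generated $R$-module $N$ assigns to each $S\subseteq E$ a submodule $\rho(S)\subseteq N$ such that $\operatorname{rank}_R\rho(S)=\operatorname{rank}_M(S)$, $\rho(\emptyset)=0$, $\rho(E)=N$, $\rho(S_1)\subseteq\rho(S_2)$ whenever $S_1\subseteq S_2\subseteq E$, and $\rho(S_1)=\rho(S_2)$ whenever moreover $\operatorname{rank}_M(S_1)=\operatorname{rank}_M(S_2)$. Fix a total order on $E$. The graded cochain complex $C^{\bullet}(M,\rho)$ has chain groups $$C^{i,j}(M,\rho)=\bigoplus_{S\subseteq E,\ |S|=i}\textstyle\bigwedge^j\bigl(N/\rho(S)\bigr)\qquad(i,j\ge 0),$$ and its differential $d^{i,j}:C^{i,j}\to C^{i+1,j}$ is, on the summand of $S$, the sum over $e\in E\setminus S$ of $\epsilon^{S,e}=(-1)^{|\{e'\in S\,:\,e'<e\}|}$ times the map $\bigwedge^j(N/\rho(S))\to\bigwedge^j(N/\rho(S\cup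 e))$ induced by the projection. Let $H^{i,j}(M,\rho)$ be its cohomology. Let $(M,\rho)$ and $(M',\rho')$ be matroids with $R$-quasi-representations (in $N$ and $N'$) on disjoint finite ground sets $E$ and $E'$. Their direct sum $(M,\rho)\oplus(M',\rho')$ is the matroid $M\oplus M'$ on $E\cup E'$ with the quasi-representation $S\mapsto\rho(S\cap E)\oplus\rho'(S\cap E')\subseteq N\oplus N'$. Fix any total order on $E\cup E'$ and use its restrictions to $E$ and $E'$. The tensor product of two graded complexes $A,B$ is $$(A\otimes B)^{i,j}=\bigoplus_{a+a'=i,\ b+b'=j}A^{a,b}\otimes_R B^{a',b'},\qquad d(x\otimes y)=dx\otimes y+(-1)^{a}x\otimes dy\quad(x\in A^{a,b}).$$ **Proposition.** There is an isomorphism of graded cochain complexes of $R$-modules $$\Phi:\;C^{\bullet}(M,\rho)\otimes C^{\bullet}(M',\rho')\;\xrightarrow{\ \cong\ }\;C^{\bullet}\bigl((M,\rho)\oplus(M',\rho')\bigr).$$ If moreover $R$ is a field, then for all $i,j\ge 0$ the rule $[x]\otimes[y]\mapsto[\Phi(x\otimes y)]$ is a well-defined isomorphism of $R$-vector spaces $$\bigoplus_{l=0}^{i}\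 \bigoplus_{j'=0}^{j}H^{i-l,\,j-j'}(M,\rho)\otimes_R H^{l,j'}(M',\rho')\;\xrightarrow{\ \cong\ }\;H^{i,j}\bigl((M,\rho)\oplus(M',\rho')\bigr).$$ -/

import Mathlib

open scoped TensorProduct DirectSum

noncomputable section

namespace MatroidCohomology

universe u v w

/-! ## Graded cochain complexes -/

/-- A graded cochain complex of `R`-modules, concentrated in cohomological degrees `i ≥ 0` and
internal degrees `j ≥ 0`.  The chain group in cohomological degree `i` is the graded module
`⨁ j, X i j`, and the differential raises `i` by one and preserves `j`. -/
structure GradedComplex (R : Type u) [CommRing R] where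
  X : ℕ → ℕ → Type v
  [addCommGroup : ∀ i j, AddCommGroup (X i j)]
  [module : ∀ i j, Module R (X i j)]
  d : ∀ i j, X i j →ₗ[R] X (i + 1) j
  d_comp_d : ∀ i j, d (i + 1) j ∘ₗ d i j = 0

attribute [instance] GradedComplex.addCommGroup GradedComplex.module

namespace GradedComplex

variable {R : Type u} [CommRing R]

/-- The cocycles in bidegree `(i, j)`. -/
def cocycles (A : GradedComplex.{u, v} R) (i j : ℕ) : Submodule R (A.X i j) :=
  LinearMap.ker (A.d i j)

/-- The coboundaries in bidegree `(i, j)`. -/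
def coboundaries (A : GradedComplex.{u, v} R) : ∀ i j : ℕ, Submodule R (A.X i j)
  | 0, _ => ⊥
  | i + 1, j => LinearMap.range (A.d i j)

/-- The cohomology `H^{i,j}`: cocycles modulo coboundaries. -/
abbrev cohomology (A : GradedComplex.{u, v} R) (i j : ℕ) : Type v :=
  A.cocycles i j ⧸ (A.coboundaries i j).submoduleOf (A.cocycles i j)

/-- The cohomology class of a cocycle. -/
def cohomologyClass (A : GradedComplex.{u, v} R) {i j : ℕ} (x : A.cocycles i j) :
    A.cohomology i j :=
  Submodule.Quotient.mk x

/-- An isomorphism of graded cochain complexes. -/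
structure Iso (A : GradedComplex.{u, v} R) (B : GradedComplex.{u, w} R) where
  equiv : ∀ i j, A.X i j ≃ₗ[R] B.X i j
  comm : ∀ i j (x : A.X i j), equiv (i + 1) j (A.d i j x) = B.d i j (equiv i j x)

/-- Pairs of pairs of natural numbers, the first with sum `i` and the second with sum `j`. -/
abbrev Split (i j : ℕ) : Type :=
  {p : ℕ × ℕ // p.1 + p.2 = i} × {q : ℕ × ℕ // q.1 + q.2 = j}

/-- The bidegree `(i, j)` part of the tensor product of two graded complexes: the direct sum of
the `A^{i', j'} ⊗ B^{i'', j''}` with `i' + i'' = i` and `j' + j'' = j`. -/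
abbrev TensorX (A : GradedComplex.{u, v} R) (B : GradedComplex.{u, w} R) (i j : ℕ) :
    Type (max v w) :=
  ⨁ s : Split i j, A.X s.1.1.1 s.2.1.1 ⊗[R] B.X s.1.1.2 s.2.1.2

/-- The inclusion of the summand `A^{a, b} ⊗ B^{a', b'}` of the tensor product. -/
def tensorIncl (A : GradedComplex.{u, v} R) (B : GradedComplex.{u, w} R) {i j a a' b b' : ℕ}
    (hi : a + a' = i) (hj : b + b' = j) :
    A.X a b ⊗[R] B.X a' b' →ₗ[R] TensorX A B i j :=
  DirectSum.lof R (Split i j)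
    (fun s : Split i j => A.X s.1.1.1 s.2.1.1 ⊗[R] B.X s.1.1.2 s.2.1.2)
    (⟨(a, a'), hi⟩, ⟨(b, b'), hj⟩)

/-- The differential `d (x ⊗ y) = d x ⊗ y + (-1)^{a} x ⊗ d y`, where `a` is the cohomological
degree of `x`. -/
def tensorD (A : GradedComplex.{u, v} R) (B : GradedComplex.{u, w} R) (i j : ℕ) :
    TensorX A B i j →ₗ[R] TensorX A B (i + 1) j :=
  DirectSum.toModule R (Split i j) (TensorX A B (i + 1) j) fun s =>
    tensorIncl A B (by have := s.1.2; omega) s.2.2 ∘ₗ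
        (A.d s.1.1.1 s.2.1.1).rTensor (B.X s.1.1.2 s.2.1.2) +
      ((-1 : R) ^ s.1.1.1) •
        (tensorIncl A B (by have := s.1.2; omega) s.2.2 ∘ₗ
          (B.d s.1.1.2 s.2.1.2).lTensor (A.X s.1.1.1 s.2.1.1))

theorem tensorD_tensorIncl (A : GradedComplex.{u, v} R) (B : GradedComplex.{u, w} R)
    {i j a a' b b' : ℕ} (hi : a + a' = i) (hj : b + b' = j) (x : A.X a b) (y : B.X a' b') :
    tensorD A B i j (tensorIncl A B hi hj (x ⊗ₜ y)) =
      tensorIncl A B (by omega) hj (A.d a b x ⊗ₜ y) +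
        ((-1 : R) ^ a) • tensorIncl A B (by omega) hj (x ⊗ₜ B.d a' b' y) := by
  rw [tensorD, tensorIncl, DirectSum.toModule_lof]
  rfl

theorem tensorD_comp_tensorD (A : GradedComplex.{u, v} R) (B : GradedComplex.{u, w} R)
    (i j : ℕ) : tensorD A B (i + 1) j ∘ₗ tensorD A B i j = 0 := by
  have hA : ∀ i j x, A.d (i + 1) j (A.d i j x) = 0 := fun i j x =>
    LinearMap.congr_fun (A.d_comp_d i j) x
  have hB : ∀ i j x, B.d (i + 1) j (B.d i j x) = 0 := fun i j x =>
    LinearMap.congr_fun (B.d_comp_d i j) x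
  refine DirectSum.linearMap_ext R fun s => TensorProduct.ext' fun x y => ?_
  change tensorD A B (i + 1) j (tensorD A B i j (tensorIncl A B s.1.2 s.2.2 (x ⊗ₜ y))) = 0
  simp only [tensorD_tensorIncl, map_add, map_smul, hA, hB, TensorProduct.zero_tmul,
    TensorProduct.tmul_zero, map_zero, smul_zero, zero_add, add_zero, pow_succ, mul_neg_one]
  rw [← add_smul, neg_add_cancel, zero_smul]

/-- The tensor product of two graded complexes. -/
abbrev tensor (A : GradedComplex.{u, v} R) (B : GradedComplex.{u, w} R) :
    GradedComplex.{u, max v w} R where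
  X := TensorX A B
  d := tensorD A B
  d_comp_d := tensorD_comp_tensorD A B

end GradedComplex

/-! ## Quasi-representations of matroids -/

/-- The rank of a module over a domain: the dimension of its base change to the fraction field. -/
def moduleRank (R : Type u) [CommRing R] [IsDomain R] (L : Type v) [AddCommGroup L]
    [Module R L] : ℕ :=
  Module.finrank (FractionRing R) (FractionRing R ⊗[R] L)

/-- An `R`-quasi-representation of `M` in the module `N`; only the values `ρ S` on subsets `S` of
the ground set of `M` are meaningful. -/
structure QuasiRep (R : Type u) [CommRing R] [IsDomain R] {α : Type v} (M : Matroid α)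
    (N : Type w) [AddCommGroup N] [Module R N] where
  ρ : Set α → Submodule R N
  rank_eq : ∀ S, S ⊆ M.E → (moduleRank R (ρ S) : ℕ∞) = M.eRk S
  empty_eq : ρ ∅ = ⊥
  ground_eq : ρ M.E = ⊤
  mono : ∀ S T, S ⊆ T → T ⊆ M.E → ρ S ≤ ρ T
  eq_of_rank_eq : ∀ S T, S ⊆ T → T ⊆ M.E → M.eRk S = M.eRk T → ρ S = ρ T

section DirectSum

instance finite_disjointSum {α : Type v} (M M' : Matroid α) (h : Disjoint M.E M'.E) [M.Finite]
    [M'.Finite] : (M.disjointSum M' h).Finite :=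
  ⟨by
    rw [Matroid.disjointSum_ground_eq]
    exact M.ground_finite.union M'.ground_finite⟩

theorem eRk_disjointSum {α : Type v} (M M' : Matroid α) (h : Disjoint M.E M'.E) (S : Set α)
    (hS : S ⊆ M.E ∪ M'.E) :
    (M.disjointSum M' h).eRk S = M.eRk (S ∩ M.E) + M'.eRk (S ∩ M'.E) := by
  obtain ⟨I, hI⟩ := (M.disjointSum M' h).exists_isBasis S (by simpa using hS)
  rw [hI.eRk_eq_encard]
  have hI' := hI
  rw [Matroid.disjointSum_isBasis_iff] at hI'
  obtain ⟨h1, h2, hIS, -⟩ := hI'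
  rw [h1.eRk_eq_encard, h2.eRk_eq_encard, ← Set.encard_union_eq, ← Set.inter_union_distrib_left,
    Set.inter_eq_self_of_subset_left (hIS.trans hS)]
  exact h.mono Set.inter_subset_right Set.inter_subset_right

theorem moduleRank_prod (R : Type u) [CommRing R] [IsDomain R] {N : Type v} {N' : Type w}
    [AddCommGroup N] [Module R N] [AddCommGroup N'] [Module R N'] [IsNoetherian R N]
    [IsNoetherian R N'] (p : Submodule R N) (p' : Submodule R N') :
    moduleRank R (p.prod p') = moduleRank R p + moduleRank R p' := by
  unfold moduleRank
  let e0 : p.prod p' ≃ₗ[R] p × p' :=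
    { toFun := fun x => (⟨x.1.1, x.2.1⟩, ⟨x.1.2, x.2.2⟩)
      invFun := fun x => ⟨(x.1, x.2), x.1.2, x.2.2⟩
      map_add' := fun _ _ => rfl
      map_smul' := fun _ _ => rfl }
  have e : FractionRing R ⊗[R] (p.prod p') ≃ₗ[FractionRing R]
      (FractionRing R ⊗[R] p) × (FractionRing R ⊗[R] p') :=
    (TensorProduct.AlgebraTensorModule.congr (LinearEquiv.refl _ _) e0).trans
      (TensorProduct.prodRight R (FractionRing R) (FractionRing R) p p')
  rw [e.finrank_eq, Module.finrank_prod]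

variable {R : Type u} [CommRing R] [IsDomain R] [IsPrincipalIdealRing R] {α : Type*}
  {M M' : Matroid α} [M.Finite] [M'.Finite] {N : Type v} {N' : Type w}
  [AddCommGroup N] [Module R N] [Module.Finite R N]
  [AddCommGroup N'] [Module R N'] [Module.Finite R N']

/-- The direct sum quasi-representation `S ↦ ρ (S ∩ E) ⊕ ρ' (S ∩ E')` in `N ⊕ N'` of the direct
sum of two matroids on disjoint ground sets `E` and `E'`. -/
def QuasiRep.directSum (ρ : QuasiRep R M N) (ρ' : QuasiRep R M' N') (h : Disjoint M.E M'.E) :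
    QuasiRep R (M.disjointSum M' h) (N × N') where
  ρ S := (ρ.ρ (S ∩ M.E)).prod (ρ'.ρ (S ∩ M'.E))
  rank_eq S hS := by
    rw [Matroid.disjointSum_ground_eq] at hS
    rw [moduleRank_prod, eRk_disjointSum M M' h S hS, Nat.cast_add,
      ρ.rank_eq _ Set.inter_subset_right, ρ'.rank_eq _ Set.inter_subset_right]
  empty_eq := by simp [ρ.empty_eq, ρ'.empty_eq]
  ground_eq := by
    have h1 : (M.E ∪ M'.E) ∩ M.E = M.E := Set.union_inter_cancel_left
    have h2 : (M.E ∪ M'.E) ∩ M'.E = M'.E := Set.union_inter_cancel_right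
    rw [Matroid.disjointSum_ground_eq, h1, h2, ρ.ground_eq, ρ'.ground_eq, Submodule.prod_top]
  mono S T hST _ := Submodule.prod_mono
    (ρ.mono _ _ (Set.inter_subset_inter_left _ hST) Set.inter_subset_right)
    (ρ'.mono _ _ (Set.inter_subset_inter_left _ hST) Set.inter_subset_right)
  eq_of_rank_eq S T hST hT hr := by
    rw [Matroid.disjointSum_ground_eq] at hT
    rw [eRk_disjointSum M M' h S (hST.trans hT), eRk_disjointSum M M' h T hT] at hr
    have i1 : S ∩ M.E ⊆ T ∩ M.E := Set.inter_subset_inter_left _ hST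
    have i2 : S ∩ M'.E ⊆ T ∩ M'.E := Set.inter_subset_inter_left _ hST
    have l1 := M.eRk_mono i1
    have l2 := M'.eRk_mono i2
    rw [← ρ.rank_eq _ Set.inter_subset_right, ← ρ.rank_eq _ Set.inter_subset_right] at l1
    rw [← ρ'.rank_eq _ Set.inter_subset_right, ← ρ'.rank_eq _ Set.inter_subset_right] at l2
    rw [← ρ.rank_eq _ Set.inter_subset_right, ← ρ.rank_eq _ Set.inter_subset_right,
      ← ρ'.rank_eq _ Set.inter_subset_right, ← ρ'.rank_eq _ Set.inter_subset_right] at hr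
    norm_cast at l1 l2 hr
    congr 1
    · refine ρ.eq_of_rank_eq _ _ i1 Set.inter_subset_right ?_
      rw [← ρ.rank_eq _ Set.inter_subset_right, ← ρ.rank_eq _ Set.inter_subset_right]
      norm_cast
      omega
    · refine ρ'.eq_of_rank_eq _ _ i2 Set.inter_subset_right ?_
      rw [← ρ'.rank_eq _ Set.inter_subset_right, ← ρ'.rank_eq _ Set.inter_subset_right]
      norm_cast
      omega

end DirectSum

/-! ## The characteristic cohomology -/

/-- The sign `ε^{S,e} = (-1)^{#{e' ∈ S | e' < e}}`. -/
def sign (R : Type u) [CommRing R] {α : Type*} [LinearOrder α] (S : Finset α) (e : α) : R :=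
  (-1) ^ (S.filter fun e' => e' < e).card

theorem sign_mul_sign (R : Type u) [CommRing R] {α : Type*} [LinearOrder α] (S : Finset α)
    {e f : α} (he : e ∉ S) (hf : f ∉ S) (hef : e ≠ f) :
    sign R S e * sign R (insert e S) f + sign R S f * sign R (insert f S) e = 0 := by
  have key : ∀ a b : α, a ∉ S → a < b →
      sign R S a * sign R (insert a S) b + sign R S b * sign R (insert b S) a = 0 := by
    intro a b ha hab
    have h1 : (insert a S).filter (fun e' => e' < b) = insert a (S.filter fun e' => e' < b) := by
      rw [Finset.filter_insert, if_pos hab]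
    have h2 : (insert b S).filter (fun e' => e' < a) = S.filter fun e' => e' < a := by
      rw [Finset.filter_insert, if_neg hab.le.not_gt]
    rw [sign, sign, sign, sign, h1, h2, Finset.card_insert_of_notMem (by simp [ha]), pow_succ]
    ring
  rcases lt_or_gt_of_ne hef with h | h
  · exact key e f he h
  · rw [add_comm]
    exact key f e hf h

section Complex

variable {R : Type u} [CommRing R] [IsDomain R] {α : Type*} [LinearOrder α]
  {M : Matroid α} [M.Finite] {N : Type w} [AddCommGroup N] [Module R N]

/-- The subsets of cardinality `i` of the ground set of `M`. -/
abbrev Subs (M : Matroid α) (i : ℕ) : Type _ := {S : Finset α // (S : Set α) ⊆ M.E ∧ S.card = i}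

/-- The elements of the ground set of `M` that are not in `S`. -/
def outside (M : Matroid α) [M.Finite] (S : Finset α) : Finset α := M.ground_finite.toFinset \ S

theorem mem_outside {S : Finset α} {e : α} : e ∈ outside M S ↔ e ∈ M.E ∧ e ∉ S := by
  simp [outside]

/-- The set `S ∪ {e}` for `e ∉ S`. -/
def Subs.insert {i : ℕ} (S : Subs M i) (e : outside M S.1) : Subs M (i + 1) :=
  ⟨Insert.insert e.1 S.1, by
    rw [Finset.coe_insert]
    exact Set.insert_subset (mem_outside.1 e.2).1 S.2.1, by
    rw [Finset.card_insert_of_notMem (mem_outside.1 e.2).2, S.2.2]⟩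

/-- The chain group `C^{S,j} = ⋀^j (N / ρ(S))`. -/
abbrev chainAt (ρ : QuasiRep R M N) (S : Finset α) (j : ℕ) : Type _ := ⋀[R]^j (N ⧸ ρ.ρ (S : Set α))

/-- The map `d^{S,e} : ⋀^j (N / ρ(S)) → ⋀^j (N / ρ(S ∪ e))` induced by the projection. -/
def dAt (ρ : QuasiRep R M N) {i : ℕ} (S : Subs M i) (e : outside M S.1) (j : ℕ) :
    chainAt ρ S.1 j →ₗ[R] chainAt ρ (S.insert e).1 j :=
  exteriorPower.map j (Submodule.factor (ρ.mono _ _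
    (Finset.coe_subset.2 (Finset.subset_insert e.1 S.1)) (S.insert e).2.1))

/-- The chain group `C^{i,j}`, the direct sum of the `C^{S,j}` over the subsets `S` of the ground
set with `i` elements. -/
abbrev chainGroup (ρ : QuasiRep R M N) (i j : ℕ) : Type _ := ⨁ S : Subs M i, chainAt ρ S.1 j

/-- The inclusion of the summand `C^{S,j}`. -/
abbrev chainIncl (ρ : QuasiRep R M N) {i : ℕ} (S : Subs M i) (j : ℕ) :
    chainAt ρ S.1 j →ₗ[R] chainGroup ρ i j :=
  DirectSum.lof R (Subs M i) (fun S : Subs M i => chainAt ρ S.1 j) S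

/-- The differential: on the summand `C^{S,j}` it is the sum over `e ∉ S` of the maps
`ε^{S,e} d^{S,e}`. -/
def chainD (ρ : QuasiRep R M N) (i j : ℕ) : chainGroup ρ i j →ₗ[R] chainGroup ρ (i + 1) j :=
  DirectSum.toModule R (Subs M i) (chainGroup ρ (i + 1) j) fun S =>
    ∑ e : outside M S.1, sign R S.1 e.1 • (chainIncl ρ (S.insert e) j ∘ₗ dAt ρ S e j)

theorem chainIncl_factor_congr (ρ : QuasiRep R M N) {i : ℕ} (S : Finset α) (j : ℕ)
    {T T' : Subs M i} (hT : T = T') (h : ρ.ρ S ≤ ρ.ρ T.1) (h' : ρ.ρ S ≤ ρ.ρ T'.1)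
    (x : chainAt ρ S j) :
    chainIncl ρ T j (exteriorPower.map j (Submodule.factor h) x) =
      chainIncl ρ T' j (exteriorPower.map j (Submodule.factor h') x) := by
  subst hT
  rfl

theorem dAt_dAt (ρ : QuasiRep R M N) {i : ℕ} (S : Subs M i) (e : outside M S.1)
    (f : outside M (S.insert e).1) (j : ℕ) (x : chainAt ρ S.1 j)
    (h : ρ.ρ (S.1 : Set α) ≤ ρ.ρ ((S.insert e).insert f).1) :
    dAt ρ (S.insert e) f j (dAt ρ S e j x) = exteriorPower.map j (Submodule.factor h) x := by
  rw [dAt, dAt, ← LinearMap.comp_apply, ← exteriorPower.map_comp, Submodule.factor_comp]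

theorem chainD_chainIncl (ρ : QuasiRep R M N) {i : ℕ} (S : Subs M i) (j : ℕ)
    (x : chainAt ρ S.1 j) :
    chainD ρ i j (chainIncl ρ S j x) =
      ∑ e : outside M S.1, sign R S.1 e.1 • chainIncl ρ (S.insert e) j (dAt ρ S e j x) := by
  rw [chainD, DirectSum.toModule_lof, LinearMap.sum_apply]
  rfl

theorem chainD_comp_chainD (ρ : QuasiRep R M N) (i j : ℕ) :
    chainD ρ (i + 1) j ∘ₗ chainD ρ i j = 0 := by
  refine DirectSum.linearMap_ext R fun S => LinearMap.ext fun x => ?_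
  change chainD ρ (i + 1) j (chainD ρ i j (chainIncl ρ S j x)) = 0
  have hle : ∀ (e : outside M S.1) (f : outside M (S.insert e).1),
      ρ.ρ (S.1 : Set α) ≤ ρ.ρ ((S.insert e).insert f).1 := fun e f =>
    ρ.mono _ _ (Finset.coe_subset.2 ((Finset.subset_insert _ _).trans (Finset.subset_insert _ _)))
      ((S.insert e).insert f).2.1
  have hmem : ∀ (e : outside M S.1) (f : outside M (S.insert e).1),
      f.1 ∈ outside M S.1 ∧ e.1 ≠ f.1 := fun e f => by
    have hf := mem_outside.1 f.2
    have hf2 : f.1 ∉ insert e.1 S.1 := hf.2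
    rw [Finset.mem_insert, not_or] at hf2
    exact ⟨mem_outside.2 ⟨hf.1, hf2.2⟩, fun h => hf2.1 h.symm⟩
  have hmem' : ∀ (e : outside M S.1) (f : outside M (S.insert e).1),
      e.1 ∈ outside M (S.insert ⟨f.1, (hmem e f).1⟩).1 := fun e f => by
    refine mem_outside.2 ⟨(mem_outside.1 e.2).1, ?_⟩
    change e.1 ∉ insert f.1 S.1
    rw [Finset.mem_insert, not_or]
    exact ⟨(hmem e f).2, (mem_outside.1 e.2).2⟩
  simp only [chainD_chainIncl, map_sum, map_smul, Finset.smul_sum, smul_smul]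
  rw [Finset.sum_sigma']
  refine Finset.sum_involution
    (fun p _ => ⟨⟨p.2.1, (hmem p.1 p.2).1⟩, ⟨p.1.1, hmem' p.1 p.2⟩⟩) ?_ ?_ ?_ ?_
  · rintro ⟨e, f⟩ -
    have hT : (S.insert ⟨f.1, (hmem e f).1⟩).insert ⟨e.1, hmem' e f⟩ = (S.insert e).insert f :=
      Subtype.ext (Finset.insert_comm e.1 f.1 S.1)
    rw [dAt_dAt ρ S e f j x (hle e f), dAt_dAt ρ S _ ⟨e.1, hmem' e f⟩ j x (hle _ _),
      chainIncl_factor_congr ρ S.1 j hT (hle _ _) (hle e f), ← add_smul]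
    have := sign_mul_sign R S.1 (mem_outside.1 e.2).2 (mem_outside.1 (hmem e f).1).2 (hmem e f).2
    exact (congrArg (· • _) this).trans (zero_smul R _)
  · rintro ⟨e, f⟩ - - h
    have := congrArg (fun p => p.1.1) h
    exact (hmem e f).2 this.symm
  · intro p _
    simp
  · rintro ⟨e, f⟩ -
    rfl

/-- The complex `C(M, ρ)`, whose cohomology is the characteristic cohomology of `(M, ρ)`. -/
abbrev charComplex (ρ : QuasiRep R M N) : GradedComplex R where
  X := chainGroup ρ
  d := chainD ρ
  d_comp_d := chainD_comp_chainD ρ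

end Complex

end MatroidCohomology

end

/-!
On the summand indexed by `S` and `S'`, the isomorphism `Φ` is the sign of the shuffle of `S` and
`S'` times the product `⋀ (N / ρ(S)) ⊗ ⋀ (N' / ρ'(S')) → ⋀ (N / ρ(S) ⊕ N' / ρ'(S'))`. The exterior
algebra turns direct sums into tensor products, so `Φ` is bijective, and the shuffle signs are what
makes it commute with the differentials.

Over a field, let `g` be a generalized inverse of the differential, `d g d = d`. Then
`e = 1 - (d g + g d)` is homotopic to the identity, takes values in the cocycles and kills the
coboundaries. Since tensor products of maps respect homotopies, `e ⊗ e'` is homotopic to the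
identity of the tensor product, so a cocycle whose image in `H ⊗ H'` vanishes is a coboundary.
-/

noncomputable section

namespace MatroidCohomology

universe u v w v'

section DirectSumLemmas

variable {R ι κ : Type*} [Semiring R] [DecidableEq ι] [DecidableEq κ] {X : κ → Type*}
  [∀ k, AddCommMonoid (X k)] [∀ k, Module R (X k)]

theorem toModule_lof_comp_bijective {Y : ι → Type*} [∀ i, AddCommMonoid (Y i)]
    [∀ i, Module R (Y i)] {e : κ → ι} (he : Function.Bijective e) {φ : ∀ k, X k →ₗ[R] Y (e k)}
    (hφ : ∀ k, Function.Bijective (φ k)) :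
    Function.Bijective
      (DirectSum.toModule R κ (⨁ i, Y i) fun k => DirectSum.lof R ι Y (e k) ∘ₗ φ k) := by
  let reindex : (⨁ k, Y (e k)) ≃ₗ[R] ⨁ i, Y i :=
    (DirectSum.lequivCongrLeft R (Equiv.ofBijective e he).symm).symm
  have factor : (DirectSum.toModule R κ (⨁ i, Y i) fun k => DirectSum.lof R ι Y (e k) ∘ₗ φ k) =
      reindex.toLinearMap ∘ₗ DirectSum.lmap φ := by
    refine DirectSum.linearMap_ext R fun k => LinearMap.ext fun x => ?_
    simp only [LinearMap.comp_apply, DirectSum.toModule_lof, DirectSum.lmap_lof]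
    exact (DirectSum.lequivCongrLeft_symm_lof R (h := (Equiv.ofBijective e he).symm)).symm
  rw [factor, LinearMap.coe_comp]
  exact reindex.bijective.comp ⟨(DirectSum.lmap_injective φ).2 fun k => (hφ k).1,
    (DirectSum.lmap_surjective φ).2 fun k => (hφ k).2⟩

theorem toModule_homogeneous_bijective {V : Type*} [AddCommMonoid V] [Module R V]
    (𝒜 : ι → Submodule R V) [DirectSum.Decomposition 𝒜] (G : (⨁ k, X k) ≃ₗ[R] V) {deg : κ → ι}
    (hG : ∀ k x, G (DirectSum.lof R κ X k x) ∈ 𝒜 (deg k)) (i : ι)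
    (φ : ∀ k : {k // deg k = i}, X k →ₗ[R] 𝒜 i)
    (hφ : ∀ k x, (φ k x : V) = G (DirectSum.lof R κ X k x)) :
    Function.Bijective (DirectSum.toModule R {k // deg k = i} (𝒜 i) φ) := by
  let incl : (⨁ k : {k // deg k = i}, X k) →ₗ[R] ⨁ k, X k :=
    DirectSum.toModule R _ _ fun k => DirectSum.lof R κ X k
  let restrict : (⨁ k, X k) →ₗ[R] ⨁ k : {k // deg k = i}, X k :=
    DirectSum.toModule R _ _ fun k => if hk : deg k = i then
      DirectSum.lof R {k // deg k = i} (fun k => X k) ⟨k, hk⟩ else 0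
  let proj : V →ₗ[R] 𝒜 i :=
    DirectSum.component R ι (fun i => 𝒜 i) i ∘ₗ (DirectSum.decomposeLinearEquiv 𝒜).toLinearMap
  have proj_apply : ∀ v, proj v = DirectSum.decompose 𝒜 v i := fun v => rfl
  have restrict_incl : restrict ∘ₗ incl = LinearMap.id := by
    refine DirectSum.linearMap_ext R fun k => LinearMap.ext fun x => ?_
    simp only [LinearMap.comp_apply, incl, restrict, DirectSum.toModule_lof, dif_pos k.2,
      LinearMap.id_apply]
  have coe_toModule : (𝒜 i).subtype ∘ₗ DirectSum.toModule R _ (𝒜 i) φ = G.toLinearMap ∘ₗ incl := by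
    refine DirectSum.linearMap_ext R fun k => LinearMap.ext fun x => ?_
    simp only [LinearMap.comp_apply, incl, DirectSum.toModule_lof, LinearEquiv.coe_coe,
      Submodule.subtype_apply, hφ]
  have toModule_restrict : DirectSum.toModule R _ (𝒜 i) φ ∘ₗ restrict = proj ∘ₗ G.toLinearMap := by
    refine DirectSum.linearMap_ext R fun k => LinearMap.ext fun x => Subtype.ext ?_
    simp only [LinearMap.comp_apply, restrict, DirectSum.toModule_lof, LinearEquiv.coe_coe,
      proj_apply]
    split_ifs with hk
    · rw [DirectSum.toModule_lof, hφ, DirectSum.decompose_of_mem_same 𝒜 (hk ▸ hG k x)]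
    · rw [LinearMap.zero_apply, map_zero, DirectSum.decompose_of_mem_ne 𝒜 (hG k x) hk,
        ZeroMemClass.coe_zero]
  constructor
  · have := G.injective.comp (LinearMap.injective_of_comp_eq_id _ _ restrict_incl)
    rw [← LinearEquiv.coe_coe, ← LinearMap.coe_comp, ← coe_toModule, LinearMap.coe_comp] at this
    exact this.of_comp
  · intro z
    refine ⟨restrict (G.symm z), (LinearMap.congr_fun toModule_restrict (G.symm z)).trans ?_⟩
    rw [LinearMap.comp_apply, LinearEquiv.coe_coe, G.apply_symm_apply, proj_apply,
      DirectSum.decompose_coe, DirectSum.of_eq_same]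

end DirectSumLemmas

/-! ### Exterior powers of a direct sum -/

section ExteriorPowers

variable {R : Type*} [CommRing R] {A B C D : Type*} [AddCommGroup A] [Module R A]
  [AddCommGroup B] [Module R B] [AddCommGroup C] [Module R C] [AddCommGroup D] [Module R D]

theorem coe_exteriorPower_map (n : ℕ) (f : A →ₗ[R] B) (x : ⋀[R]^n A) :
    (exteriorPower.map n f x : ExteriorAlgebra R B) = ExteriorAlgebra.map f x := by
  have : (⋀[R]^n B).subtype ∘ₗ exteriorPower.map n f =
      (ExteriorAlgebra.map f).toLinearMap ∘ₗ (⋀[R]^n A).subtype := by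
    refine exteriorPower.linearMap_ext ?_
    ext v
    simp
  exact LinearMap.congr_fun this x

/-- The product `x ⊗ y ↦ f x ∧ g y` of exterior powers along linear maps `f` and `g` with the same
target. The target degree is a variable so that no casts between exterior powers are needed. -/
def wedge (f : A →ₗ[R] C) (g : B →ₗ[R] C) {a b j : ℕ} (h : a + b = j) :
    ⋀[R]^a A ⊗[R] ⋀[R]^b B →ₗ[R] ⋀[R]^j C :=
  Submodule.inclusion (le_of_eq (by rw [h])) ∘ₗ
    TensorProduct.lift ((DirectSum.gMulLHom R fun n : ℕ => ⋀[R]^n C).compl₁₂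
      (exteriorPower.map a f) (exteriorPower.map b g))

theorem coe_wedge_tmul (f : A →ₗ[R] C) (g : B →ₗ[R] C) {a b j : ℕ} (h : a + b = j)
    (x : ⋀[R]^a A) (y : ⋀[R]^b B) :
    (wedge f g h (x ⊗ₜ y) : ExteriorAlgebra R C) =
      ExteriorAlgebra.map f (x : ExteriorAlgebra R A) *
        ExteriorAlgebra.map g (y : ExteriorAlgebra R B) := by
  rw [← coe_exteriorPower_map, ← coe_exteriorPower_map]
  rfl

theorem map_wedge (k : C →ₗ[R] D) (f : A →ₗ[R] C) (g : B →ₗ[R] C) {a b j : ℕ} (h : a + b = j)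
    (t : ⋀[R]^a A ⊗[R] ⋀[R]^b B) :
    exteriorPower.map j k (wedge f g h t) = wedge (k ∘ₗ f) (k ∘ₗ g) h t := by
  induction t with
  | zero => simp only [map_zero]
  | add s t hs ht => simp only [map_add, hs, ht]
  | tmul x y =>
    refine Subtype.ext ?_
    rw [coe_exteriorPower_map, coe_wedge_tmul, coe_wedge_tmul, map_mul, ← AlgHom.comp_apply,
      ← AlgHom.comp_apply, ExteriorAlgebra.map_comp_map, ExteriorAlgebra.map_comp_map]

theorem wedge_map_left (k : D →ₗ[R] A) (f : A →ₗ[R] C) (g : B →ₗ[R] C) {a b j : ℕ}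
    (h : a + b = j) (x : ⋀[R]^a D) (y : ⋀[R]^b B) :
    wedge f g h (exteriorPower.map a k x ⊗ₜ y) = wedge (f ∘ₗ k) g h (x ⊗ₜ y) := by
  refine Subtype.ext ?_
  rw [coe_wedge_tmul, coe_wedge_tmul, coe_exteriorPower_map, ← AlgHom.comp_apply,
    ExteriorAlgebra.map_comp_map]

theorem wedge_map_right (k : D →ₗ[R] B) (f : A →ₗ[R] C) (g : B →ₗ[R] C) {a b j : ℕ}
    (h : a + b = j) (x : ⋀[R]^a A) (y : ⋀[R]^b D) :
    wedge f g h (x ⊗ₜ exteriorPower.map b k y) = wedge f (g ∘ₗ k) h (x ⊗ₜ y) := by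
  refine Subtype.ext ?_
  rw [coe_wedge_tmul, coe_wedge_tmul, coe_exteriorPower_map, ← AlgHom.comp_apply,
    ExteriorAlgebra.map_comp_map]

/-- Pairs of natural numbers with sum `j`, so that `GradedComplex.Split i j` is
`SumPair i × SumPair j`. -/
abbrev SumPair (j : ℕ) : Type := {q : ℕ × ℕ // q.1 + q.2 = j}

variable (R A B) in
/-- The summand `⋀^a A ⊗ ⋀^b B` of `⋀ A ⊗ ⋀ B` indexed by `q = (a, b)`. -/
abbrev BiPower (q : ℕ × ℕ) : Type _ := ⋀[R]^q.1 A ⊗[R] ⋀[R]^q.2 B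

/-- The sum of the products `⋀^a A ⊗ ⋀^b B → ⋀^j C` over `a + b = j`. -/
def wedgeSum (f : A →ₗ[R] C) (g : B →ₗ[R] C) (j : ℕ) :
    (⨁ q : SumPair j, BiPower R A B q.1) →ₗ[R] ⋀[R]^j C :=
  DirectSum.toModule R (SumPair j) (⋀[R]^j C) fun q => wedge f g q.2

theorem wedgeSum_lof (f : A →ₗ[R] C) (g : B →ₗ[R] C) (j : ℕ) (q : SumPair j)
    (t : BiPower R A B q.1) :
    wedgeSum f g j (DirectSum.lof R (SumPair j) (fun q => BiPower R A B q.1) q t) =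
      wedge f g q.2 t :=
  DirectSum.toModule_lof ..

variable (R A B) in
/-- The isometry between the zero quadratic form on `A × B` written as an orthogonal sum and the
zero form whose Clifford algebra is `ExteriorAlgebra R (A × B)`. -/
def zeroProdIsometryEquiv :
    ((0 : QuadraticForm R A).prod (0 : QuadraticForm R B)).IsometryEquiv
      (0 : QuadraticForm R (A × B)) where
  __ := LinearEquiv.refl R (A × B)
  map_app' _ := by simp

variable (R A B) in
/-- The canonical isomorphism `⋀ A ⊗ ⋀ B ≃ ⋀ (A × B)`, which is that of Clifford algebras for
zero quadratic forms. -/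
def exteriorAlgebraProdEquiv :
    ExteriorAlgebra R A ⊗[R] ExteriorAlgebra R B ≃ₗ[R] ExteriorAlgebra R (A × B) :=
  (GradedTensorProduct.of R (CliffordAlgebra.evenOdd (0 : QuadraticForm R A))
      (CliffordAlgebra.evenOdd (0 : QuadraticForm R B))) ≪≫ₗ
    ((CliffordAlgebra.prodEquiv 0 0).symm.trans
      (CliffordAlgebra.equivOfIsometry (zeroProdIsometryEquiv R A B))).toLinearEquiv

theorem exteriorAlgebraProdEquiv_tmul (x : ExteriorAlgebra R A) (y : ExteriorAlgebra R B) :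
    exteriorAlgebraProdEquiv R A B (x ⊗ₜ y) =
      ExteriorAlgebra.map (LinearMap.inl R A B) x *
        ExteriorAlgebra.map (LinearMap.inr R A B) y := by
  change CliffordAlgebra.map (zeroProdIsometryEquiv R A B).toIsometry
    (CliffordAlgebra.toProd 0 0 (GradedTensorProduct.tmul R x y)) = _
  rw [CliffordAlgebra.toProd, GradedTensorProduct.lift_tmul, map_mul, ← AlgHom.comp_apply,
    ← AlgHom.comp_apply, CliffordAlgebra.map_comp_map, CliffordAlgebra.map_comp_map]
  rfl

variable (R A B) in
/-- The isomorphism `⨁ (⋀^a A ⊗ ⋀^b B) ≃ ⋀ (A × B)`. -/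
def biPowerEquiv : (⨁ q : ℕ × ℕ, BiPower R A B q) ≃ₗ[R] ExteriorAlgebra R (A × B) :=
  (TensorProduct.directSum R R (fun a : ℕ => ⋀[R]^a A) (fun b : ℕ => ⋀[R]^b B)).symm ≪≫ₗ
    TensorProduct.congr (DirectSum.decomposeLinearEquiv fun a : ℕ => ⋀[R]^a A).symm
      (DirectSum.decomposeLinearEquiv fun b : ℕ => ⋀[R]^b B).symm ≪≫ₗ
    exteriorAlgebraProdEquiv R A B

theorem biPowerEquiv_lof (q : ℕ × ℕ) (t : BiPower R A B q) :
    biPowerEquiv R A B (DirectSum.lof R (ℕ × ℕ) (BiPower R A B) q t) =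
      wedge (LinearMap.inl R A B) (LinearMap.inr R A B) (rfl : q.1 + q.2 = q.1 + q.2) t := by
  induction t using TensorProduct.induction_on with
  | zero => simp only [map_zero, ZeroMemClass.coe_zero]
  | add s t hs ht => simp only [map_add, hs, ht, Submodule.coe_add]
  | tmul x y =>
    simp only [biPowerEquiv, LinearEquiv.trans_apply, coe_wedge_tmul]
    rw [TensorProduct.directSum_symm_lof_tmul, TensorProduct.congr_tmul,
      exteriorAlgebraProdEquiv_tmul, DirectSum.decomposeLinearEquiv_symm_lof,
      DirectSum.decomposeLinearEquiv_symm_lof]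

theorem wedgeSum_inl_inr_bijective (j : ℕ) :
    Function.Bijective (wedgeSum (LinearMap.inl R A B) (LinearMap.inr R A B) j) := by
  refine toModule_homogeneous_bijective (fun n : ℕ => ⋀[R]^n (A × B)) (biPowerEquiv R A B)
    (deg := fun q => q.1 + q.2) (fun q t => ?_) j _ ?_
  · rw [biPowerEquiv_lof]
    exact Subtype.prop _
  · rintro ⟨q, rfl⟩ t
    exact (biPowerEquiv_lof q t).symm

theorem wedgeSum_bijective {f : A →ₗ[R] C} {g : B →ₗ[R] C}
    (h : Function.Bijective (f.coprod g)) (j : ℕ) : Function.Bijective (wedgeSum f g j) := by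
  have factor : wedgeSum f g j = exteriorPower.map j (f.coprod g) ∘ₗ
      wedgeSum (LinearMap.inl R A B) (LinearMap.inr R A B) j := by
    refine DirectSum.linearMap_ext R fun q => LinearMap.ext fun t => ?_
    simp only [LinearMap.comp_apply, wedgeSum_lof, map_wedge, LinearMap.coprod_inl,
      LinearMap.coprod_inr]
  let e := LinearEquiv.ofBijective (f.coprod g) h
  rw [factor, LinearMap.coe_comp]
  exact Function.Bijective.comp ⟨exteriorPower.map_injective e.symm.toLinearMap
    (LinearMap.ext e.symm_apply_apply), exteriorPower.map_surjective h.2⟩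
    (wedgeSum_inl_inr_bijective j)

end ExteriorPowers

/-! ### The Künneth isomorphism over a semisimple ring -/

section GeneralizedInverse

variable {R V W : Type*} [Ring R] [AddCommGroup V] [Module R V] [AddCommGroup W] [Module R W]

theorem exists_generalizedInverse [IsSemisimpleModule R V] [IsSemisimpleModule R W]
    (f : V →ₗ[R] W) : ∃ g : W →ₗ[R] V, f ∘ₗ g ∘ₗ f = f := by
  obtain ⟨s, hs⟩ := IsSemisimpleModule.lifting_property f.rangeRestrict f.surjective_rangeRestrict
    LinearMap.id
  obtain ⟨g, hg⟩ := IsSemisimpleModule.extension_property f.range.subtype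
    f.range.subtype_injective s
  refine ⟨g, LinearMap.ext fun v => ?_⟩
  have section_apply : g (f v) = s (f.rangeRestrict v) :=
    LinearMap.congr_fun hg (f.rangeRestrict v)
  have lift_apply : f.rangeRestrict (s (f.rangeRestrict v)) = f.rangeRestrict v :=
    LinearMap.congr_fun hs (f.rangeRestrict v)
  change f (g (f v)) = f v
  rw [section_apply]
  exact congrArg Subtype.val lift_apply

end GeneralizedInverse

namespace GradedComplex

variable {R : Type u} [CommRing R]

section Homotopy

variable {A B : GradedComplex.{u, v} R}

theorem d_d (A : GradedComplex.{u, v} R) {i j : ℕ} (x : A.X i j) :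
    A.d (i + 1) j (A.d i j x) = 0 :=
  LinearMap.congr_fun (A.d_comp_d i j) x

theorem cohomologyClass_eq_iff (A : GradedComplex.{u, v} R) {i j : ℕ} (x y : A.cocycles i j) :
    A.cohomologyClass x = A.cohomologyClass y ↔ x.1 - y.1 ∈ A.coboundaries i j :=
  Submodule.Quotient.eq _

theorem cohomologyClass_eq_zero_iff (A : GradedComplex.{u, v} R) {i j : ℕ} (x : A.cocycles i j) :
    A.cohomologyClass x = 0 ↔ x.1 ∈ A.coboundaries i j :=
  Submodule.Quotient.mk_eq_zero _

/-- Families of linear maps between the chain groups of two complexes, not required to commute with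
the differentials. -/
abbrev BigradedMap (A B : GradedComplex.{u, v} R) : Type _ := ∀ i j, A.X i j →ₗ[R] B.X i j

/-- The property of a family of linear maps to commute with the differentials. -/
def IsChainMap (f : BigradedMap A B) : Prop :=
  ∀ i j x, f (i + 1) j (A.d i j x) = B.d i j (f i j x)

/-- The map `d h + h d` for a family `h` of linear maps of degree `-1`; in degree `0` the term
`d h` is absent. -/
def homotopyBoundary (h : ∀ i j, A.X (i + 1) j →ₗ[R] B.X i j) : BigradedMap A B
  | 0, j => h 0 j ∘ₗ A.d 0 j
  | i + 1, j => B.d i j ∘ₗ h i j + h (i + 1) j ∘ₗ A.d (i + 1) j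

/-- The property of a map to be homotopic to zero. -/
def NullHomotopic (f : BigradedMap A B) : Prop :=
  ∃ h : ∀ i j, A.X (i + 1) j →ₗ[R] B.X i j, f = homotopyBoundary h

theorem NullHomotopic.apply_mem_coboundaries {f : BigradedMap A B} (hf : NullHomotopic f)
    {i j : ℕ} {x : A.X i j} (hx : x ∈ A.cocycles i j) : f i j x ∈ B.coboundaries i j := by
  obtain ⟨h, rfl⟩ := hf
  have hx : A.d i j x = 0 := hx
  cases i with
  | zero => simp only [homotopyBoundary, LinearMap.comp_apply, hx, map_zero, Submodule.zero_mem]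
  | succ i =>
    refine ⟨h i j x, ?_⟩
    simp only [homotopyBoundary, LinearMap.add_apply, LinearMap.comp_apply, hx, map_zero, add_zero]

end Homotopy

section Cohomology

/-- The cohomology of a graded complex as a graded complex with zero differential. -/
def cohomologyComplex (A : GradedComplex.{u, v} R) : GradedComplex.{u, v} R where
  X := A.cohomology
  d _ _ := 0
  d_comp_d _ _ := LinearMap.comp_zero _

variable {A : GradedComplex.{u, v} R} {B : GradedComplex.{u, w} R} (Φ : Iso A B) (i j : ℕ)

theorem Iso.map_cocycles : (A.cocycles i j).map (Φ.equiv i j).toLinearMap = B.cocycles i j := by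
  ext y
  rw [Submodule.mem_map_equiv, cocycles, cocycles, LinearMap.mem_ker, LinearMap.mem_ker,
    ← (Φ.equiv (i + 1) j).map_eq_zero_iff, Φ.comm, LinearEquiv.apply_symm_apply]

theorem Iso.map_coboundaries :
    (A.coboundaries i j).map (Φ.equiv i j).toLinearMap = B.coboundaries i j := by
  cases i with
  | zero => exact Submodule.map_bot _
  | succ i =>
    have comm : (Φ.equiv (i + 1) j).toLinearMap ∘ₗ A.d i j =
        B.d i j ∘ₗ (Φ.equiv i j).toLinearMap := LinearMap.ext (Φ.comm i j)
    exact (LinearMap.range_comp _ _).symm.trans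
      ((congrArg LinearMap.range comm).trans (LinearEquiv.range_comp _ _))

theorem Iso.equiv_mem_cocycles (x : A.cocycles i j) : Φ.equiv i j x ∈ B.cocycles i j :=
  Φ.map_cocycles i j ▸ Submodule.mem_map_of_mem x.2

/-- The isomorphism on cohomology induced by an isomorphism of graded complexes. -/
def Iso.cohomologyEquiv : A.cohomology i j ≃ₗ[R] B.cohomology i j :=
  Submodule.Quotient.equiv _ _ ((Φ.equiv i j).ofSubmodules _ _ (Φ.map_cocycles i j)) <| by
    ext y
    rw [Submodule.mem_map_equiv, Submodule.submoduleOf, Submodule.submoduleOf,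
      ← Φ.map_coboundaries, Submodule.mem_comap, Submodule.mem_comap]
    exact (Submodule.mem_map_equiv _).symm

theorem Iso.cohomologyEquiv_cohomologyClass (x : A.cocycles i j) :
    Φ.cohomologyEquiv i j (A.cohomologyClass x) =
      B.cohomologyClass ⟨_, Φ.equiv_mem_cocycles i j x⟩ :=
  rfl

end Cohomology

section Splitting

/-- A choice of generalized inverses of the differentials of a graded complex. -/
structure Splitting (A : GradedComplex.{u, v} R) where
  inv : ∀ i j, A.X (i + 1) j →ₗ[R] A.X i j
  d_inv_d : ∀ i j x, A.d i j (inv i j (A.d i j x)) = A.d i j x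

theorem nonempty_splitting [IsSemisimpleRing R] (A : GradedComplex.{u, v} R) :
    Nonempty A.Splitting := by
  choose g hg using fun i j => exists_generalizedInverse (A.d i j)
  exact ⟨⟨g, fun i j => LinearMap.congr_fun (hg i j)⟩⟩

namespace Splitting

variable {A : GradedComplex.{u, v} R} (s : A.Splitting)

/-- The endomorphism `1 - (d g + g d)`, where `g` is the generalized inverse of `d`. It is homotopic
to the identity and takes values in the cocycles. -/
def retract : BigradedMap A A := fun i j => LinearMap.id - homotopyBoundary s.inv i j

theorem d_retract (i j : ℕ) (x : A.X i j) : A.d i j (s.retract i j x) = 0 := by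
  cases i <;>
  simp only [retract, homotopyBoundary, LinearMap.sub_apply, LinearMap.add_apply,
    LinearMap.comp_apply, LinearMap.id_apply, map_sub, map_add, A.d_d, s.d_inv_d, zero_add,
    sub_self]

theorem retract_d (i j : ℕ) (x : A.X i j) : s.retract (i + 1) j (A.d i j x) = 0 := by
  simp only [retract, homotopyBoundary, LinearMap.sub_apply, LinearMap.add_apply,
    LinearMap.comp_apply, LinearMap.id_apply, A.d_d, s.d_inv_d, map_zero, add_zero, sub_self]

theorem isChainMap_retract : IsChainMap s.retract := fun i j x =>
  (s.retract_d i j x).trans (s.d_retract i j x).symm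

theorem retract_eq_zero_of_mem_coboundaries {i j : ℕ} {x : A.X i j}
    (hx : x ∈ A.coboundaries i j) : s.retract i j x = 0 := by
  cases i with
  | zero => rw [(Submodule.mem_bot R).1 hx, map_zero]
  | succ i =>
    obtain ⟨y, rfl⟩ := hx
    exact s.retract_d i j y

/-- The projection `x ↦ [e x]` onto the cohomology, where `e` is the retraction onto cocycles. -/
def proj : BigradedMap A A.cohomologyComplex := fun i j =>
  Submodule.mkQ _ ∘ₗ (s.retract i j).codRestrict (A.cocycles i j) (s.d_retract i j)

/-- The map `[z] ↦ e z` from the cohomology, where `e` is the retraction onto cocycles. -/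
def sect : BigradedMap A.cohomologyComplex A := fun i j =>
  Submodule.liftQ _ (s.retract i j ∘ₗ (A.cocycles i j).subtype)
    fun _ hz => s.retract_eq_zero_of_mem_coboundaries hz

theorem sect_proj (i j : ℕ) (x : A.X i j) :
    s.sect i j (s.proj i j x) = s.retract i j (s.retract i j x) :=
  rfl

theorem proj_cocycle {i j : ℕ} (z : A.cocycles i j) : s.proj i j z = A.cohomologyClass z := by
  refine (A.cohomologyClass_eq_iff _ _).2 ?_
  have : s.retract i j z - z = -homotopyBoundary s.inv i j z := by
    simp only [retract, LinearMap.sub_apply, LinearMap.id_apply]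
    abel
  refine this ▸ Submodule.neg_mem _ ?_
  exact NullHomotopic.apply_mem_coboundaries ⟨s.inv, rfl⟩ z.2

theorem proj_d (i j : ℕ) (x : A.X i j) : s.proj (i + 1) j (A.d i j x) = 0 :=
  (congrArg (Submodule.mkQ _) (Subtype.ext (s.retract_d i j x))).trans (map_zero _)

end Splitting

end Splitting

section Tensor

variable {A A' : GradedComplex.{u, v} R} {B B' : GradedComplex.{u, w} R}

theorem tensorX_ext {i j : ℕ} {Q : Type*} [AddCommMonoid Q] [Module R Q]
    {f g : TensorX A B i j →ₗ[R] Q}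
    (h : ∀ (a a' b b' : ℕ) (hi : a + a' = i) (hj : b + b' = j) (x : A.X a b) (y : B.X a' b'),
      f (tensorIncl A B hi hj (x ⊗ₜ y)) = g (tensorIncl A B hi hj (x ⊗ₜ y))) : f = g :=
  DirectSum.linearMap_ext R fun s => TensorProduct.ext' fun x y =>
    h s.1.1.1 s.1.1.2 s.2.1.1 s.2.1.2 s.1.2 s.2.2 x y

/-- The map `f ⊗ g` on tensor products of graded complexes. No sign is involved, since `f` and `g`
have degree `0`. -/
def tensorMap (f : BigradedMap A A') (g : BigradedMap B B') (i j : ℕ) :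
    TensorX A B i j →ₗ[R] TensorX A' B' i j :=
  DirectSum.toModule R (Split i j) (TensorX A' B' i j) fun s =>
    tensorIncl A' B' s.1.2 s.2.2 ∘ₗ TensorProduct.map (f s.1.1.1 s.2.1.1) (g s.1.1.2 s.2.1.2)

theorem tensorMap_tensorIncl (f : BigradedMap A A') (g : BigradedMap B B') {i j a a' b b' : ℕ}
    (hi : a + a' = i) (hj : b + b' = j) (x : A.X a b) (y : B.X a' b') :
    tensorMap f g i j (tensorIncl A B hi hj (x ⊗ₜ y)) =
      tensorIncl A' B' hi hj (f a b x ⊗ₜ g a' b' y) := by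
  rw [tensorMap, tensorIncl, DirectSum.toModule_lof]
  rfl

/-- The summand `h ⊗ g` of the homotopy induced on a tensor product by a homotopy `h` of the left
factor. It vanishes on the summands of degree `0` on the left. -/
def homotopyTensorAt (h : ∀ i j, A.X (i + 1) j →ₗ[R] A'.X i j) (g : BigradedMap B B')
    {i j b b' : ℕ} (hj : b + b' = j) :
    ∀ {a a' : ℕ}, a + a' = i + 1 → (A.X a b ⊗[R] B.X a' b' →ₗ[R] TensorX A' B' i j)
  | 0, _, _ => 0
  | a + 1, a', hi => tensorIncl A' B' (by omega) hj ∘ₗ TensorProduct.map (h a b) (g a' b')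

/-- The summand `± f ⊗ h` of the homotopy induced on a tensor product by a homotopy `h` of the right
factor, with the sign of moving `h` past the left factor. -/
def tensorHomotopyAt (f : BigradedMap A A') (h : ∀ i j, B.X (i + 1) j →ₗ[R] B'.X i j)
    {i j b b' : ℕ} (hj : b + b' = j) :
    ∀ {a a' : ℕ}, a + a' = i + 1 → (A.X a b ⊗[R] B.X a' b' →ₗ[R] TensorX A' B' i j)
  | _, 0, _ => 0
  | a, a' + 1, hi => (-1 : R) ^ a • (tensorIncl A' B' (by omega) hj ∘ₗ
      TensorProduct.map (f a b) (h a' b'))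

/-- The map of degree `-1` on a tensor product given by its restrictions to the summands. -/
def lowerTensor (H : ∀ {i j b b' : ℕ}, b + b' = j → ∀ {a a' : ℕ}, a + a' = i + 1 →
      (A.X a b ⊗[R] B.X a' b' →ₗ[R] TensorX A' B' i j)) (i j : ℕ) :
    TensorX A B (i + 1) j →ₗ[R] TensorX A' B' i j :=
  DirectSum.toModule R (Split (i + 1) j) (TensorX A' B' i j) fun s => H s.2.2 s.1.2

theorem lowerTensor_tensorIncl (H : ∀ {i j b b' : ℕ}, b + b' = j → ∀ {a a' : ℕ}, a + a' = i + 1 →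
      (A.X a b ⊗[R] B.X a' b' →ₗ[R] TensorX A' B' i j)) {i j a a' b b' : ℕ}
    (hi : a + a' = i + 1) (hj : b + b' = j) (t : A.X a b ⊗[R] B.X a' b') :
    lowerTensor H i j (tensorIncl A B hi hj t) = H hj hi t := by
  rw [lowerTensor, tensorIncl, DirectSum.toModule_lof]

theorem homotopyTensorAt_zero_tmul (h : ∀ i j, A.X (i + 1) j →ₗ[R] A'.X i j)
    (g : BigradedMap B B') {i j a' b b' : ℕ} (hj : b + b' = j) (hi : 0 + a' = i + 1)
    (x : A.X 0 b) (y : B.X a' b') : homotopyTensorAt h g hj hi (x ⊗ₜ y) = 0 :=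
  rfl

theorem homotopyTensorAt_succ_tmul (h : ∀ i j, A.X (i + 1) j →ₗ[R] A'.X i j)
    (g : BigradedMap B B') {i j a a' b b' : ℕ} (hj : b + b' = j) (hi : a + 1 + a' = i + 1)
    (x : A.X (a + 1) b) (y : B.X a' b') :
    homotopyTensorAt h g hj hi (x ⊗ₜ y) =
      tensorIncl A' B' (by omega) hj (h a b x ⊗ₜ g a' b' y) :=
  rfl

theorem tensorHomotopyAt_zero_tmul (f : BigradedMap A A')
    (h : ∀ i j, B.X (i + 1) j →ₗ[R] B'.X i j) {i j a b b' : ℕ} (hj : b + b' = j)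
    (hi : a + 0 = i + 1) (x : A.X a b) (y : B.X 0 b') :
    tensorHomotopyAt f h hj hi (x ⊗ₜ y) = 0 := by
  cases a <;> rfl

theorem tensorHomotopyAt_succ_tmul (f : BigradedMap A A')
    (h : ∀ i j, B.X (i + 1) j →ₗ[R] B'.X i j) {i j a a' b b' : ℕ} (hj : b + b' = j)
    (hi : a + (a' + 1) = i + 1) (x : A.X a b) (y : B.X (a' + 1) b') :
    tensorHomotopyAt f h hj hi (x ⊗ₜ y) =
      (-1 : R) ^ a • tensorIncl A' B' (by omega) hj (f a b x ⊗ₜ h a' b' y) := by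
  cases a <;> rfl

theorem NullHomotopic.tensorMap_left {f : BigradedMap A A'} (hf : NullHomotopic f)
    {g : BigradedMap B B'} (hg : IsChainMap g) :
    NullHomotopic (A := A.tensor B) (B := A'.tensor B') (tensorMap f g) := by
  obtain ⟨h, rfl⟩ := hf
  refine ⟨lowerTensor (homotopyTensorAt h g), funext₂ fun i j =>
    tensorX_ext fun a a' b b' hi hj x y => (tensorMap_tensorIncl ..).trans ?_⟩
  have hg : ∀ i j x, g (i + 1) j (B.d i j x) = B'.d i j (g i j x) := hg
  rcases i with _ | i <;> rcases a with _ | a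
  · simp only [homotopyBoundary, LinearMap.comp_apply, tensorD_tensorIncl, map_add,
      map_smul, lowerTensor_tensorIncl, homotopyTensorAt_succ_tmul,
      homotopyTensorAt_zero_tmul, smul_zero, add_zero]
  · omega
  · simp only [homotopyBoundary, LinearMap.comp_apply, LinearMap.add_apply, tensorD_tensorIncl,
      map_add, map_smul, lowerTensor_tensorIncl, homotopyTensorAt_succ_tmul,
      homotopyTensorAt_zero_tmul, smul_zero, add_zero, map_zero, zero_add]
  · simp only [homotopyBoundary, LinearMap.comp_apply, LinearMap.add_apply, tensorD_tensorIncl,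
      map_add, map_smul, lowerTensor_tensorIncl, homotopyTensorAt_succ_tmul,
      hg, TensorProduct.add_tmul, pow_succ]
    module

theorem NullHomotopic.tensorMap_right {f : BigradedMap A A'} (hf : IsChainMap f)
    {g : BigradedMap B B'} (hg : NullHomotopic g) :
    NullHomotopic (A := A.tensor B) (B := A'.tensor B') (tensorMap f g) := by
  obtain ⟨h, rfl⟩ := hg
  refine ⟨lowerTensor (tensorHomotopyAt f h), funext₂ fun i j =>
    tensorX_ext fun a a' b b' hi hj x y => (tensorMap_tensorIncl ..).trans ?_⟩
  have hf : ∀ i j x, f (i + 1) j (A.d i j x) = A'.d i j (f i j x) := hf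
  have sign_mul_self : (-1 : R) ^ a * (-1) ^ a = 1 := by rw [← mul_pow]; simp
  rcases i with _ | i <;> rcases a' with _ | a'
  · simp only [homotopyBoundary, LinearMap.comp_apply, tensorD_tensorIncl, map_add,
      map_smul, lowerTensor_tensorIncl, tensorHomotopyAt_succ_tmul,
      tensorHomotopyAt_zero_tmul, zero_add, smul_smul, sign_mul_self, one_smul]
  · omega
  · simp only [homotopyBoundary, LinearMap.comp_apply, LinearMap.add_apply, tensorD_tensorIncl,
      map_add, map_smul, lowerTensor_tensorIncl, tensorHomotopyAt_succ_tmul,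
      tensorHomotopyAt_zero_tmul, zero_add, map_zero, smul_smul, sign_mul_self, one_smul]
  · simp only [homotopyBoundary, LinearMap.comp_apply, LinearMap.add_apply, tensorD_tensorIncl,
      map_add, map_smul, lowerTensor_tensorIncl, tensorHomotopyAt_succ_tmul,
      hf, TensorProduct.tmul_add, smul_add, smul_smul, sign_mul_self, one_smul, pow_succ]
    module

end Tensor

section CrossProduct

variable (A : GradedComplex.{u, v} R) (B : GradedComplex.{u, w} R)

theorem tensorIncl_mem_cocycles {i j a a' b b' : ℕ} (hi : a + a' = i) (hj : b + b' = j)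
    (x : A.cocycles a b) (y : B.cocycles a' b') :
    tensorIncl A B hi hj (x.1 ⊗ₜ y.1) ∈ (A.tensor B).cocycles i j := by
  have hx : A.d a b x.1 = 0 := x.2
  have hy : B.d a' b' y.1 = 0 := y.2
  change tensorD A B i j _ = 0
  rw [tensorD_tensorIncl, hx, hy, TensorProduct.zero_tmul, TensorProduct.tmul_zero, map_zero,
    map_zero, smul_zero, add_zero]

variable {A B}

theorem tensorIncl_mem_coboundaries_left {i j a a' b b' : ℕ} (hi : a + a' = i) (hj : b + b' = j)
    {x : A.X a b} (hx : x ∈ A.coboundaries a b) (y : B.cocycles a' b') :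
    tensorIncl A B hi hj (x ⊗ₜ y.1) ∈ (A.tensor B).coboundaries i j := by
  have hy : B.d a' b' y.1 = 0 := y.2
  rcases a with _ | a
  · rw [(Submodule.mem_bot R).1 hx, TensorProduct.zero_tmul, map_zero]
    exact Submodule.zero_mem _
  · obtain ⟨w, rfl⟩ := hx
    obtain rfl : a + a' + 1 = i := by omega
    refine ⟨tensorIncl A B rfl hj (w ⊗ₜ y.1), (tensorD_tensorIncl ..).trans ?_⟩
    rw [hy, TensorProduct.tmul_zero, map_zero, smul_zero, add_zero]

theorem tensorIncl_mem_coboundaries_right {i j a a' b b' : ℕ} (hi : a + a' = i) (hj : b + b' = j)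
    (x : A.cocycles a b) {y : B.X a' b'} (hy : y ∈ B.coboundaries a' b') :
    tensorIncl A B hi hj (x.1 ⊗ₜ y) ∈ (A.tensor B).coboundaries i j := by
  have hx : A.d a b x.1 = 0 := x.2
  rcases a' with _ | a'
  · rw [(Submodule.mem_bot R).1 hy, TensorProduct.tmul_zero, map_zero]
    exact Submodule.zero_mem _
  · obtain ⟨w, rfl⟩ := hy
    obtain rfl : a + a' + 1 = i := by omega
    refine ⟨(-1 : R) ^ a • tensorIncl A B rfl hj (x.1 ⊗ₜ w),
      (map_smul ..).trans ((congrArg _ (tensorD_tensorIncl ..)).trans ?_)⟩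
    rw [hx, TensorProduct.zero_tmul, map_zero, zero_add, smul_smul, ← mul_pow, neg_one_mul,
      neg_neg, one_pow, one_smul]

variable (A B)

/-- The product of cocycles in the cohomology of a tensor product. -/
def cocycleProduct {i j a a' b b' : ℕ} (hi : a + a' = i) (hj : b + b' = j) :
    A.cocycles a b ⊗[R] B.cocycles a' b' →ₗ[R] (A.tensor B).cohomology i j :=
  TensorProduct.lift <| LinearMap.mk₂ R
    (fun x y => (A.tensor B).cohomologyClass ⟨_, tensorIncl_mem_cocycles A B hi hj x y⟩)
    (fun x x' y => congrArg (Submodule.mkQ _) (Subtype.ext <| by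
      simp only [Submodule.coe_add, TensorProduct.add_tmul, map_add]))
    (fun c x y => congrArg (Submodule.mkQ _) (Subtype.ext <| by
      simp only [Submodule.coe_smul, ← TensorProduct.smul_tmul', map_smul]))
    (fun x y y' => congrArg (Submodule.mkQ _) (Subtype.ext <| by
      simp only [Submodule.coe_add, TensorProduct.tmul_add, map_add]))
    (fun c x y => congrArg (Submodule.mkQ _) (Subtype.ext <| by
      simp only [Submodule.coe_smul, TensorProduct.tmul_smul, map_smul]))

/-- The cohomology cross product on a summand of the tensor product of cohomologies. -/
def crossProductAt {i j a a' b b' : ℕ} (hi : a + a' = i) (hj : b + b' = j) :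
    A.cohomologyComplex.X a b ⊗[R] B.cohomologyComplex.X a' b' →ₗ[R] (A.tensor B).cohomology i j :=
  Submodule.liftQ _ (cocycleProduct A B hi hj) (sup_le
      ((LinearMap.range_le_ker_iff).2 <| TensorProduct.ext' fun x y =>
        (cohomologyClass_eq_zero_iff _ _).2 <| tensorIncl_mem_coboundaries_left hi hj x.2 y)
      ((LinearMap.range_le_ker_iff).2 <| TensorProduct.ext' fun x y =>
        (cohomologyClass_eq_zero_iff _ _).2 <| tensorIncl_mem_coboundaries_right hi hj x y.2)) ∘ₗ
    (TensorProduct.quotientTensorQuotientEquiv _ _).toLinearMap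

/-- The cohomology cross product `[x] ⊗ [y] ↦ [x ⊗ y]`. -/
def crossProduct (i j : ℕ) :
    TensorX A.cohomologyComplex B.cohomologyComplex i j →ₗ[R] (A.tensor B).cohomology i j :=
  DirectSum.toModule R (Split i j) _ fun s => crossProductAt A B s.1.2 s.2.2

theorem crossProduct_tensorIncl {i j a a' b b' : ℕ} (hi : a + a' = i) (hj : b + b' = j)
    (x : A.cocycles a b) (y : B.cocycles a' b') :
    crossProduct A B i j (tensorIncl A.cohomologyComplex B.cohomologyComplex hi hj
        (A.cohomologyClass x ⊗ₜ B.cohomologyClass y)) =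
      (A.tensor B).cohomologyClass ⟨_, tensorIncl_mem_cocycles A B hi hj x y⟩ := by
  rw [crossProduct, tensorIncl, DirectSum.toModule_lof]
  rfl

variable {A B} (s : A.Splitting) (t : B.Splitting)

theorem tensorMap_proj_eq_zero_of_mem_coboundaries {i j : ℕ} {x : TensorX A B i j}
    (hx : x ∈ (A.tensor B).coboundaries i j) : tensorMap s.proj t.proj i j x = 0 := by
  cases i with
  | zero => rw [(Submodule.mem_bot R).1 hx, map_zero]
  | succ i =>
    obtain ⟨w, rfl⟩ := hx
    suffices tensorMap s.proj t.proj (i + 1) j ∘ₗ tensorD A B i j = 0 from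
      LinearMap.congr_fun this w
    refine tensorX_ext fun a a' b b' hi hj x y => ?_
    simp only [LinearMap.comp_apply, tensorD_tensorIncl, map_add, map_smul, tensorMap_tensorIncl,
      s.proj_d, t.proj_d, TensorProduct.zero_tmul, TensorProduct.tmul_zero, map_zero, smul_zero,
      add_zero, LinearMap.zero_apply]

theorem sub_tensorMap_retract (i j : ℕ) (x : TensorX A B i j) :
    x - tensorMap s.retract t.retract i j x =
      tensorMap (homotopyBoundary s.inv) (fun _ _ => LinearMap.id) i j x +
        tensorMap s.retract (homotopyBoundary t.inv) i j x := by
  suffices LinearMap.id - tensorMap s.retract t.retract i j =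
      tensorMap (homotopyBoundary s.inv) (fun _ _ => LinearMap.id) i j +
        tensorMap s.retract (homotopyBoundary t.inv) i j from LinearMap.congr_fun this x
  refine tensorX_ext fun a a' b b' hi hj x y => ?_
  simp only [LinearMap.sub_apply, LinearMap.add_apply, LinearMap.id_apply]
  rw [tensorMap_tensorIncl, tensorMap_tensorIncl, tensorMap_tensorIncl]
  simp only [Splitting.retract, LinearMap.sub_apply, LinearMap.id_apply, TensorProduct.sub_tmul,
    TensorProduct.tmul_sub, map_sub]
  abel

theorem mem_coboundaries_of_tensorMap_proj_eq_zero {i j : ℕ} {x : TensorX A B i j}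
    (hx : x ∈ (A.tensor B).cocycles i j) (h : tensorMap s.proj t.proj i j x = 0) :
    x ∈ (A.tensor B).coboundaries i j := by
  have sub_retract_mem : ∀ y ∈ (A.tensor B).cocycles i j,
      y - tensorMap s.retract t.retract i j y ∈ (A.tensor B).coboundaries i j := fun y hy =>
    sub_tensorMap_retract s t i j y ▸ Submodule.add_mem _
      ((NullHomotopic.tensorMap_left ⟨s.inv, rfl⟩ fun _ _ _ => rfl).apply_mem_coboundaries hy)
      ((NullHomotopic.tensorMap_right s.isChainMap_retract ⟨t.inv, rfl⟩).apply_mem_coboundaries hy)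
  set y := tensorMap s.retract t.retract i j x
  have factor : tensorMap s.retract t.retract i j ∘ₗ tensorMap s.retract t.retract i j =
      tensorMap s.sect t.sect i j ∘ₗ tensorMap s.proj t.proj i j :=
    tensorX_ext fun a a' b b' hi hj x y => by
      simp only [LinearMap.comp_apply, tensorMap_tensorIncl, Splitting.sect_proj]
  have retract_y : tensorMap s.retract t.retract i j y = 0 :=
    (LinearMap.congr_fun factor x).trans
      ((congrArg (tensorMap s.sect t.sect i j) h).trans (map_zero _))
  have d_retract : tensorD A B i j ∘ₗ tensorMap s.retract t.retract i j = 0 :=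
    tensorX_ext fun a a' b b' hi hj x y => by
      simp only [LinearMap.comp_apply, tensorMap_tensorIncl, tensorD_tensorIncl, s.d_retract,
        t.d_retract, TensorProduct.zero_tmul, TensorProduct.tmul_zero, map_zero, smul_zero,
        add_zero, LinearMap.zero_apply]
  have y_mem : y ∈ (A.tensor B).coboundaries i j := by
    simpa only [retract_y, sub_zero] using sub_retract_mem y (LinearMap.congr_fun d_retract x)
  exact (Submodule.sub_mem_iff_left _ y_mem).1 (sub_retract_mem x hx)

/-- The Künneth map `H(A ⊗ B) → H(A) ⊗ H(B)` induced by the projections onto cohomology. -/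
def kunneth (i j : ℕ) :
    (A.tensor B).cohomology i j →ₗ[R] TensorX A.cohomologyComplex B.cohomologyComplex i j :=
  Submodule.liftQ _ (tensorMap s.proj t.proj i j ∘ₗ ((A.tensor B).cocycles i j).subtype)
    fun _ hx => tensorMap_proj_eq_zero_of_mem_coboundaries s t hx

theorem kunneth_injective (i j : ℕ) : Function.Injective (kunneth s t i j) := by
  refine (injective_iff_map_eq_zero _).2 fun c hc => ?_
  obtain ⟨x, rfl⟩ := Submodule.Quotient.mk_surjective _ c
  exact (cohomologyClass_eq_zero_iff _ x).2
    (mem_coboundaries_of_tensorMap_proj_eq_zero s t x.2 hc)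

theorem kunneth_comp_crossProduct (i j : ℕ) :
    kunneth s t i j ∘ₗ crossProduct A B i j = LinearMap.id := by
  refine tensorX_ext fun a a' b b' hi hj x y => ?_
  obtain ⟨x, rfl⟩ := Submodule.Quotient.mk_surjective _ x
  obtain ⟨y, rfl⟩ := Submodule.Quotient.mk_surjective _ y
  refine (congrArg _ (crossProduct_tensorIncl A B hi hj x y)).trans ?_
  refine (tensorMap_tensorIncl s.proj t.proj hi hj x.1 y.1).trans ?_
  rw [s.proj_cocycle, t.proj_cocycle]
  rfl

variable (A B) in
theorem crossProduct_bijective [IsSemisimpleRing R] (i j : ℕ) :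
    Function.Bijective (crossProduct A B i j) := by
  obtain ⟨s⟩ := A.nonempty_splitting
  obtain ⟨t⟩ := B.nonempty_splitting
  have left_inv := LinearMap.congr_fun (kunneth_comp_crossProduct s t i j)
  exact ⟨Function.LeftInverse.injective left_inv, fun c =>
    ⟨kunneth s t i j c, kunneth_injective s t i j (left_inv _)⟩⟩

variable {C : GradedComplex.{u, v'} R}

/-- The isomorphism `[x] ⊗ [y] ↦ [Φ (x ⊗ y)]` from the tensor product of the cohomologies of `A` and
`B` to the cohomology of a complex that `Φ` identifies with `A ⊗ B`. -/
def Iso.kunnethEquiv [IsSemisimpleRing R] (Φ : Iso (A.tensor B) C) (i j : ℕ) :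
    TensorX A.cohomologyComplex B.cohomologyComplex i j ≃ₗ[R] C.cohomology i j :=
  LinearEquiv.ofBijective _ (crossProduct_bijective A B i j) ≪≫ₗ Φ.cohomologyEquiv i j

theorem Iso.kunnethEquiv_tensorIncl [IsSemisimpleRing R] (Φ : Iso (A.tensor B) C)
    {i j a a' b b' : ℕ} (hi : a + a' = i) (hj : b + b' = j) (x : A.cocycles a b)
    (y : B.cocycles a' b') :
    Φ.kunnethEquiv i j (tensorIncl A.cohomologyComplex B.cohomologyComplex hi hj
        (A.cohomologyClass x ⊗ₜ B.cohomologyClass y)) =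
      C.cohomologyClass
        ⟨_, Φ.equiv_mem_cocycles i j ⟨_, tensorIncl_mem_cocycles A B hi hj x y⟩⟩ :=
  (congrArg (Φ.cohomologyEquiv i j) (crossProduct_tensorIncl A B hi hj x y)).trans
    (Φ.cohomologyEquiv_cohomologyClass i j _)

end CrossProduct

end GradedComplex

/-! ### The complex of a direct sum of matroids -/

section Signs

variable (R : Type*) [CommRing R] {α : Type*} [LinearOrder α]

theorem sign_union {S S' : Finset α} (h : Disjoint S S') (e : α) :
    sign R (S ∪ S') e = sign R S e * sign R S' e := by
  rw [sign, sign, sign, Finset.filter_union,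
    Finset.card_union_of_disjoint (Finset.disjoint_filter_filter h), pow_add]

theorem sign_mul_self (S : Finset α) (e : α) : sign R S e * sign R S e = 1 := by
  rw [sign, ← mul_pow, neg_one_mul, neg_neg, one_pow]

/-- The sign of the permutation that sorts the concatenation of the finite sets `S` and `S'`. -/
def shuffleSign (S S' : Finset α) : R := ∏ s ∈ S, sign R S' s

theorem shuffleSign_mul_self (S S' : Finset α) : shuffleSign R S S' * shuffleSign R S S' = 1 := by
  rw [shuffleSign, ← Finset.prod_mul_distrib]
  exact Finset.prod_eq_one fun s _ => sign_mul_self R S' s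

theorem sign_mul_shuffleSign_insert_left {S S' : Finset α} (h : Disjoint S S') {e : α}
    (he : e ∉ S) :
    sign R S e * shuffleSign R (insert e S) S' = shuffleSign R S S' * sign R (S ∪ S') e := by
  rw [sign_union R h, shuffleSign, shuffleSign, Finset.prod_insert he]
  ring

theorem prod_sign_singleton {S : Finset α} {e : α} (he : e ∉ S) :
    (-1) ^ S.card * ∏ s ∈ S, sign R {e} s = sign R S e := by
  induction S using Finset.induction_on with
  | empty => simp [sign]
  | insert a S ha ih =>
    rw [Finset.mem_insert, not_or] at he
    rw [Finset.card_insert_of_notMem ha, Finset.prod_insert ha, pow_succ, Finset.insert_eq,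
      sign_union R (Finset.disjoint_singleton_left.2 ha), ← ih he.2]
    have : -1 * sign R {e} a = sign R {a} e := by
      rcases lt_or_gt_of_ne he.1 with h | h <;> simp [sign, Finset.filter_singleton, h, h.not_gt]
    rw [← this]
    ring

theorem sign_mul_shuffleSign_insert_right {S S' : Finset α} (h : Disjoint S S') {e : α}
    (he : e ∉ S) (he' : e ∉ S') :
    (-1) ^ S.card * (sign R S' e * shuffleSign R S (insert e S')) =
      shuffleSign R S S' * sign R (S ∪ S') e := by
  have shuffleSign_insert :
      shuffleSign R S (insert e S') = (∏ s ∈ S, sign R {e} s) * shuffleSign R S S' := by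
    rw [shuffleSign, shuffleSign, ← Finset.prod_mul_distrib, Finset.insert_eq]
    exact Finset.prod_congr rfl fun s _ => sign_union R (Finset.disjoint_singleton_left.2 he') s
  rw [shuffleSign_insert, sign_union R h, ← prod_sign_singleton R he]
  ring

end Signs

section QuotientProd

variable {R : Type*} [CommRing R] {N N' : Type*} [AddCommGroup N] [Module R N] [AddCommGroup N']
  [Module R N']

theorem coprod_mapQ_bijective (p : Submodule R N) (p' : Submodule R N')
    (P : Submodule R (N × N')) (hP : P = p.prod p') (h : p ≤ P.comap (LinearMap.inl R N N'))
    (h' : p' ≤ P.comap (LinearMap.inr R N N')) :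
    Function.Bijective ((p.mapQ P _ h).coprod (p'.mapQ P _ h')) := by
  have coprod_mk : ∀ x y, (p.mapQ P _ h).coprod (p'.mapQ P _ h')
      (Submodule.Quotient.mk x, Submodule.Quotient.mk y) = Submodule.Quotient.mk (x, y) :=
    fun x y => by
      rw [LinearMap.coprod_apply, Submodule.mapQ_apply, Submodule.mapQ_apply,
        ← Submodule.Quotient.mk_add]
      simp
  constructor
  · refine (injective_iff_map_eq_zero _).2 ?_
    rintro ⟨x, y⟩ hxy
    obtain ⟨x, rfl⟩ := Submodule.mkQ_surjective _ x
    obtain ⟨y, rfl⟩ := Submodule.mkQ_surjective _ y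
    rw [Submodule.mkQ_apply, Submodule.mkQ_apply, coprod_mk, Submodule.Quotient.mk_eq_zero,
      hP] at hxy
    exact Prod.ext ((Submodule.Quotient.mk_eq_zero _).2 hxy.1)
      ((Submodule.Quotient.mk_eq_zero _).2 hxy.2)
  · intro z
    obtain ⟨⟨x, y⟩, rfl⟩ := Submodule.mkQ_surjective _ z
    exact ⟨_, coprod_mk x y⟩

end QuotientProd

section Union

variable {α : Type*} {M M' : Matroid α}

theorem disjoint_of_subset_ground (h : Disjoint M.E M'.E) {S S' : Finset α}
    (hS : (S : Set α) ⊆ M.E) (hS' : (S' : Set α) ⊆ M'.E) : Disjoint S S' :=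
  Finset.disjoint_coe.1 (Set.disjoint_of_subset hS hS' h)

variable [LinearOrder α] (h : Disjoint M.E M'.E)

/-- The union `S ∪ S'`, as a subset of the ground set of the direct sum. -/
def Subs.union {i a a' : ℕ} (hi : a + a' = i) (S : Subs M a) (S' : Subs M' a') :
    Subs (M.disjointSum M' h) i :=
  ⟨S.1 ∪ S'.1, by
    rw [Finset.coe_union, Matroid.disjointSum_ground_eq]
    exact Set.union_subset_union S.2.1 S'.2.1, by
    rw [Finset.card_union_of_disjoint (disjoint_of_subset_ground h S.2.1 S'.2.1), S.2.2, S'.2.2,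
      hi]⟩

variable {i a a' : ℕ} (hi : a + a' = i) (S : Subs M a) (S' : Subs M' a')

theorem Subs.subset_union_left : S.1 ⊆ (S.union h hi S').1 := Finset.subset_union_left

theorem Subs.subset_union_right : S'.1 ⊆ (S.union h hi S').1 := Finset.subset_union_right

theorem Subs.coe_union_inter_left : ((S.union h hi S').1 : Set α) ∩ M.E = S.1 := by
  rw [Subs.union, Finset.coe_union, Set.union_inter_distrib_right,
    Set.inter_eq_self_of_subset_left S.2.1, (h.symm.mono_left S'.2.1).inter_eq, Set.union_empty]

theorem Subs.coe_union_inter_right : ((S.union h hi S').1 : Set α) ∩ M'.E = S'.1 := by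
  rw [Subs.union, Finset.coe_union, Set.union_inter_distrib_right,
    Set.inter_eq_self_of_subset_left S'.2.1, (h.mono_left S.2.1).inter_eq, Set.empty_union]

variable (M M' i) in
/-- Pairs of subsets `S` and `S'` of the two ground sets with `|S| + |S'| = i`. -/
abbrev SubsPair : Type _ := Σ p : SumPair i, Subs M p.1.1 × Subs M' p.1.2

/-- The union of the two members of a pair of subsets. -/
def SubsPair.union (P : SubsPair M M' i) : Subs (M.disjointSum M' h) i :=
  P.2.1.union h P.1.2 P.2.2

theorem SubsPair.union_bijective :
    Function.Bijective (SubsPair.union h : SubsPair M M' i → Subs (M.disjointSum M' h) i) := by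
  constructor
  · intro P Q hPQ
    have left_eq : P.2.1.1 = Q.2.1.1 := Finset.coe_injective <| by
      rw [← Subs.coe_union_inter_left h P.1.2 P.2.1 P.2.2,
        ← Subs.coe_union_inter_left h Q.1.2 Q.2.1 Q.2.2]
      exact congrArg (fun T => (T.1 : Set α) ∩ M.E) hPQ
    have right_eq : P.2.2.1 = Q.2.2.1 := Finset.coe_injective <| by
      rw [← Subs.coe_union_inter_right h P.1.2 P.2.1 P.2.2,
        ← Subs.coe_union_inter_right h Q.1.2 Q.2.1 Q.2.2]
      exact congrArg (fun T => (T.1 : Set α) ∩ M'.E) hPQ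
    obtain ⟨⟨⟨a, a'⟩, hi⟩, ⟨S, hS, hSa⟩, ⟨S', hS', hSa'⟩⟩ := P
    obtain ⟨⟨⟨b, b'⟩, hi'⟩, ⟨U, hU, hUb⟩, ⟨U', hU', hUb'⟩⟩ := Q
    obtain rfl : S = U := left_eq
    obtain rfl : S' = U' := right_eq
    obtain rfl : a = b := hSa.symm.trans hUb
    obtain rfl : a' = b' := hSa'.symm.trans hUb'
    rfl
  · intro T
    classical
    let S : Subs M _ := ⟨T.1.filter (· ∈ M.E), fun x hx => (Finset.mem_filter.1 hx).2, rfl⟩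
    let S' : Subs M' _ := ⟨T.1.filter (· ∈ M'.E), fun x hx => (Finset.mem_filter.1 hx).2, rfl⟩
    have hT : (T.1 : Set α) ⊆ M.E ∪ M'.E := T.2.1.trans (Matroid.disjointSum_ground_eq ..).subset
    have hSS' : S.1 ∪ S'.1 = T.1 :=
      (Finset.filter_or _ _ _).symm.trans (Finset.filter_true_of_mem fun x hx => hT hx)
    refine ⟨⟨⟨(S.1.card, S'.1.card), ?_⟩, S, S'⟩, Subtype.ext hSS'⟩
    rw [← Finset.card_union_of_disjoint (disjoint_of_subset_ground h S.2.1 S'.2.1), hSS', T.2.2]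

variable [M.Finite] [M'.Finite]

theorem mem_outside_union_left {S : Subs M a} (S' : Subs M' a') (e : outside M S.1) :
    e.1 ∈ outside (M.disjointSum M' h) (S.union h hi S').1 := by
  obtain ⟨heM, heS⟩ := mem_outside.1 e.2
  refine mem_outside.2 ⟨(Matroid.disjointSum_ground_eq ..).superset (Or.inl heM), fun he => ?_⟩
  rcases Finset.mem_union.1 he with he | he
  · exact heS he
  · exact Set.disjoint_left.1 h heM (S'.2.1 he)

theorem mem_outside_union_right (S : Subs M a) {S' : Subs M' a'} (e : outside M' S'.1) :
    e.1 ∈ outside (M.disjointSum M' h) (S.union h hi S').1 := by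
  obtain ⟨heM', heS'⟩ := mem_outside.1 e.2
  refine mem_outside.2 ⟨(Matroid.disjointSum_ground_eq ..).superset (Or.inr heM'), fun he => ?_⟩
  rcases Finset.mem_union.1 he with he | he
  · exact Set.disjoint_left.1 h (S.2.1 he) heM'
  · exact heS' he

theorem sum_outside_union {Q : Type*} [AddCommMonoid Q]
    (F : outside (M.disjointSum M' h) (S.union h hi S').1 → Q) :
    ∑ e, F e = ∑ e : outside M S.1, F ⟨e.1, mem_outside_union_left h hi S' e⟩ +
      ∑ e : outside M' S'.1, F ⟨e.1, mem_outside_union_right h hi S e⟩ := by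
  let φ : outside M S.1 ⊕ outside M' S'.1 → outside (M.disjointSum M' h) (S.union h hi S').1 :=
    Sum.elim (fun e => ⟨e.1, mem_outside_union_left h hi S' e⟩)
      (fun e => ⟨e.1, mem_outside_union_right h hi S e⟩)
  have hφ : Function.Bijective φ := by
    constructor
    · refine Function.Injective.sumElim (fun e f hef => Subtype.ext (Subtype.mk.inj hef))
        (fun e f hef => Subtype.ext (Subtype.mk.inj hef)) fun e f hef => ?_
      have hef' : e.1 = f.1 := Subtype.mk.inj hef
      exact Set.disjoint_left.1 h (mem_outside.1 e.2).1 (hef' ▸ (mem_outside.1 f.2).1)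
    · intro e
      obtain ⟨heE, heT⟩ := mem_outside.1 e.2
      obtain ⟨heS, heS'⟩ := not_or.1 (Finset.mem_union.not.1 heT)
      rcases (Matroid.disjointSum_ground_eq ..).subset heE with heM | heM'
      · exact ⟨Sum.inl ⟨e.1, mem_outside.2 ⟨heM, heS⟩⟩, rfl⟩
      · exact ⟨Sum.inr ⟨e.1, mem_outside.2 ⟨heM', heS'⟩⟩, rfl⟩
  rw [← hφ.sum_comp, Fintype.sum_sum_type]
  rfl

end Union

section DirectSumQuotient

variable {R : Type*} [CommRing R] [IsDomain R] [IsPrincipalIdealRing R] {α : Type*}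
  {M M' : Matroid α} {N N' : Type*} [AddCommGroup N] [Module R N] [Module.Finite R N]
  [AddCommGroup N'] [Module R N'] [Module.Finite R N'] (ρ : QuasiRep R M N) (ρ' : QuasiRep R M' N')
  (h : Disjoint M.E M'.E)

theorem le_comap_inl {S T : Set α} (hS : S ⊆ M.E) (hST : S ⊆ T) :
    ρ.ρ S ≤ ((ρ.directSum ρ' h).ρ T).comap (LinearMap.inl R N N') := fun _ hx =>
  ⟨ρ.mono S _ (Set.subset_inter hST hS) Set.inter_subset_right hx, Submodule.zero_mem _⟩

theorem le_comap_inr {S' T : Set α} (hS' : S' ⊆ M'.E) (hST' : S' ⊆ T) :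
    ρ'.ρ S' ≤ ((ρ.directSum ρ' h).ρ T).comap (LinearMap.inr R N N') := fun _ hx =>
  ⟨Submodule.zero_mem _, ρ'.mono S' _ (Set.subset_inter hST' hS') Set.inter_subset_right hx⟩

variable [LinearOrder α] {i j a a' b b' : ℕ} {S : Subs M a} {S' : Subs M' a'}
  {T : Subs (M.disjointSum M' h) i}

/-- The map `N / ρ(S) → (N ⊕ N') / (ρ ⊕ ρ')(T)` for `S ⊆ T`. -/
abbrev quotInl (hST : S.1 ⊆ T.1) :
    (N ⧸ ρ.ρ (S.1 : Set α)) →ₗ[R] (N × N') ⧸ (ρ.directSum ρ' h).ρ (T.1 : Set α) :=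
  Submodule.mapQ _ _ _ (le_comap_inl ρ ρ' h S.2.1 (Finset.coe_subset.2 hST))

/-- The map `N' / ρ'(S') → (N ⊕ N') / (ρ ⊕ ρ')(T)` for `S' ⊆ T`. -/
abbrev quotInr (hST' : S'.1 ⊆ T.1) :
    (N' ⧸ ρ'.ρ (S'.1 : Set α)) →ₗ[R] (N × N') ⧸ (ρ.directSum ρ' h).ρ (T.1 : Set α) :=
  Submodule.mapQ _ _ _ (le_comap_inr ρ ρ' h S'.2.1 (Finset.coe_subset.2 hST'))

/-- The product `⋀^b (N / ρ(S)) ⊗ ⋀^b' (N' / ρ'(S')) → ⋀^j ((N ⊕ N') / (ρ ⊕ ρ')(T))`. -/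
abbrev wedgeAt (hST : S.1 ⊆ T.1) (hST' : S'.1 ⊆ T.1) (hj : b + b' = j) :
    chainAt ρ S.1 b ⊗[R] chainAt ρ' S'.1 b' →ₗ[R] chainAt (ρ.directSum ρ' h) T.1 j :=
  wedge (quotInl ρ ρ' h hST) (quotInr ρ ρ' h hST') hj

theorem dAt_wedgeAt [M.Finite] [M'.Finite] (hST : S.1 ⊆ T.1) (hST' : S'.1 ⊆ T.1) (hj : b + b' = j)
    (e : outside (M.disjointSum M' h) T.1) (t : chainAt ρ S.1 b ⊗[R] chainAt ρ' S'.1 b') :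
    dAt (ρ.directSum ρ' h) T e j (wedgeAt ρ ρ' h hST hST' hj t) =
      wedgeAt ρ ρ' h (T := T.insert e) (hST.trans (Finset.subset_insert e.1 T.1))
        (hST'.trans (Finset.subset_insert e.1 T.1)) hj t := by
  rw [dAt, wedgeAt, map_wedge]
  congr 2
  · ext; rfl
  · ext; rfl

theorem wedgeAt_dAt_left [M.Finite] (e : outside M S.1) (hST : (S.insert e).1 ⊆ T.1)
    (hST' : S'.1 ⊆ T.1) (hj : b + b' = j) (x : chainAt ρ S.1 b) (y : chainAt ρ' S'.1 b') :
    wedgeAt ρ ρ' h hST hST' hj (dAt ρ S e b x ⊗ₜ y) =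
      wedgeAt ρ ρ' h ((Finset.subset_insert e.1 S.1).trans hST) hST' hj (x ⊗ₜ y) := by
  rw [dAt, wedgeAt, wedge_map_left]
  congr 2
  ext; rfl

theorem wedgeAt_dAt_right [M'.Finite] (e : outside M' S'.1) (hST : S.1 ⊆ T.1)
    (hST' : (S'.insert e).1 ⊆ T.1) (hj : b + b' = j) (x : chainAt ρ S.1 b)
    (y : chainAt ρ' S'.1 b') :
    wedgeAt ρ ρ' h hST hST' hj (x ⊗ₜ dAt ρ' S' e b' y) =
      wedgeAt ρ ρ' h hST ((Finset.subset_insert e.1 S'.1).trans hST') hj (x ⊗ₜ y) := by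
  rw [dAt, wedgeAt, wedge_map_right]
  congr 2
  ext; rfl

theorem chainIncl_wedgeAt_congr {T' : Subs (M.disjointSum M' h) i} (hT : T = T')
    (hST : S.1 ⊆ T.1) (hST' : S'.1 ⊆ T.1) (hj : b + b' = j)
    (t : chainAt ρ S.1 b ⊗[R] chainAt ρ' S'.1 b') :
    chainIncl (ρ.directSum ρ' h) T j (wedgeAt ρ ρ' h hST hST' hj t) =
      chainIncl (ρ.directSum ρ' h) T' j (wedgeAt ρ ρ' h (hT ▸ hST) (hT ▸ hST') hj t) := by
  subst hT
  rfl

variable (hi : a + a' = i) (hj : b + b' = j) (S : Subs M a) (S' : Subs M' a')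

theorem coprod_quotInl_quotInr_bijective :
    Function.Bijective ((quotInl ρ ρ' h (S.subset_union_left h hi S')).coprod
      (quotInr ρ ρ' h (S.subset_union_right h hi S'))) := by
  refine coprod_mapQ_bijective _ _ _ ?_ _ _
  change (ρ.ρ _).prod (ρ'.ρ _) = _
  rw [Subs.coe_union_inter_left, Subs.coe_union_inter_right]

/-- The product on `C^{S,b} ⊗ C^{S',b'}` with values in `C^{S∪S',b+b'}`. -/
abbrev unionWedge : chainAt ρ S.1 b ⊗[R] chainAt ρ' S'.1 b' →ₗ[R]
    chainAt (ρ.directSum ρ' h) (S.union h hi S').1 j :=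
  wedgeAt ρ ρ' h (S.subset_union_left h hi S') (S.subset_union_right h hi S') hj

/-- The product `C^{a,b}(M, ρ) ⊗ C^{a',b'}(M', ρ') → C^{a+a',b+b'}(M ⊕ M', ρ ⊕ ρ')`, which on the
summand indexed by `S` and `S'` carries the sign of the shuffle of `S` and `S'`. -/
def unionMap : chainGroup ρ a b ⊗[R] chainGroup ρ' a' b' →ₗ[R]
    chainGroup (ρ.directSum ρ' h) i j :=
  TensorProduct.lift <| DirectSum.toModule R _ _ fun S => LinearMap.flip <|
    DirectSum.toModule R _ _ fun S' => LinearMap.flip <| TensorProduct.curry <|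
      shuffleSign R S.1 S'.1 •
        (chainIncl (ρ.directSum ρ' h) (S.union h hi S') j ∘ₗ unionWedge ρ ρ' h hi hj S S')

/-- The sum over `b + b' = j` of the signed products `C^{S,b} ⊗ C^{S',b'} → C^{S∪S',j}`. -/
def signedWedgeSum (P : SubsPair M M' i) (j : ℕ) :
    (⨁ q : SumPair j,
        BiPower R (N ⧸ ρ.ρ (P.2.1.1 : Set α)) (N' ⧸ ρ'.ρ (P.2.2.1 : Set α)) q.1) →ₗ[R]
      chainAt (ρ.directSum ρ' h) (P.union h).1 j :=
  shuffleSign R P.2.1.1 P.2.2.1 •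
    wedgeSum (quotInl ρ ρ' h (P.2.1.subset_union_left h P.1.2 P.2.2))
      (quotInr ρ ρ' h (P.2.1.subset_union_right h P.1.2 P.2.2)) j

theorem signedWedgeSum_bijective (P : SubsPair M M' i) (j : ℕ) :
    Function.Bijective (signedWedgeSum ρ ρ' h P j) := by
  have sign_isUnit : IsUnit (shuffleSign R P.2.1.1 P.2.2.1) :=
    IsUnit.of_mul_eq_one _ (shuffleSign_mul_self R _ _)
  exact sign_isUnit.smul_bijective.comp (wedgeSum_bijective
    (coprod_quotInl_quotInr_bijective ρ ρ' h P.1.2 P.2.1 P.2.2) j)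

theorem signedWedgeSum_lof (P : SubsPair M M' i) (j : ℕ) (q : SumPair j)
    (t : chainAt ρ P.2.1.1 q.1.1 ⊗[R] chainAt ρ' P.2.2.1 q.1.2) :
    signedWedgeSum ρ ρ' h P j (DirectSum.lof R (SumPair j) _ q t) =
      shuffleSign R P.2.1.1 P.2.2.1 • unionWedge ρ ρ' h P.1.2 q.2 P.2.1 P.2.2 t :=
  congrArg (shuffleSign R P.2.1.1 P.2.2.1 • ·) <| wedgeSum_lof
    (quotInl ρ ρ' h (P.2.1.subset_union_left h P.1.2 P.2.2))
    (quotInr ρ ρ' h (P.2.1.subset_union_right h P.1.2 P.2.2)) j q t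

end DirectSumQuotient

section DirectSumComplex

open GradedComplex

variable {R : Type*} [CommRing R] [IsDomain R] {α : Type*} [LinearOrder α] {M M' : Matroid α}
  [M.Finite] [M'.Finite] {N N' : Type*} [AddCommGroup N] [Module R N] [AddCommGroup N']
  [Module R N']

/-- The element `x ⊗ y` of the summand indexed by `S` and `S'` of the tensor product of the
complexes of two matroids. -/
abbrev tensorGen {ρ : QuasiRep R M N} {ρ' : QuasiRep R M' N'} {i j a a' b b' : ℕ}
    (hi : a + a' = i) (hj : b + b' = j) (S : Subs M a)
    (S' : Subs M' a') (x : chainAt ρ S.1 b) (y : chainAt ρ' S'.1 b') :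
    TensorX (charComplex ρ) (charComplex ρ') i j :=
  tensorIncl (charComplex ρ) (charComplex ρ') hi hj (chainIncl ρ S b x ⊗ₜ chainIncl ρ' S' b' y)

theorem tensorGen_ext {ρ : QuasiRep R M N} {ρ' : QuasiRep R M' N'} {i j : ℕ} {Q : Type*}
    [AddCommMonoid Q] [Module R Q] {f g : TensorX (charComplex ρ) (charComplex ρ') i j →ₗ[R] Q}
    (hfg : ∀ (a a' b b' : ℕ) (hi : a + a' = i) (hj : b + b' = j) (S : Subs M a) (S' : Subs M' a')
      (x : chainAt ρ S.1 b) (y : chainAt ρ' S'.1 b'),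
      f (tensorGen hi hj S S' x y) = g (tensorGen hi hj S S' x y)) : f = g := by
  refine DirectSum.linearMap_ext R fun s => TensorProduct.ext ?_
  refine DirectSum.linearMap_ext R fun S => LinearMap.ext fun x => ?_
  refine DirectSum.linearMap_ext R fun S' => LinearMap.ext fun y => ?_
  exact hfg s.1.1.1 s.1.1.2 s.2.1.1 s.2.1.2 s.1.2 s.2.2 S S' x y

variable (ρ : QuasiRep R M N) (ρ' : QuasiRep R M' N')

theorem tensorD_tensorGen {i j a a' b b' : ℕ} (hi : a + a' = i) (hj : b + b' = j) (S : Subs M a)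
    (S' : Subs M' a') (x : chainAt ρ S.1 b) (y : chainAt ρ' S'.1 b') :
    tensorD (charComplex ρ) (charComplex ρ') i j (tensorGen hi hj S S' x y) =
      ∑ e : outside M S.1, sign R S.1 e.1 •
        tensorGen (show a + 1 + a' = i + 1 by omega) hj (S.insert e) S' (dAt ρ S e b x) y +
      (-1 : R) ^ a • ∑ e : outside M' S'.1, sign R S'.1 e.1 •
        tensorGen (show a + (a' + 1) = i + 1 by omega) hj S (S'.insert e) x (dAt ρ' S' e b' y) := by
  refine (tensorD_tensorIncl _ _ hi hj _ _).trans ?_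
  refine congrArg₂ (fun u v => tensorIncl (charComplex ρ) (charComplex ρ') _ hj (u ⊗ₜ _) +
    (-1 : R) ^ a • tensorIncl (charComplex ρ) (charComplex ρ') _ hj (_ ⊗ₜ v))
    (chainD_chainIncl ρ S b x) (chainD_chainIncl ρ' S' b' y) |>.trans ?_
  simp only [TensorProduct.sum_tmul, TensorProduct.tmul_sum, ← TensorProduct.smul_tmul',
    TensorProduct.tmul_smul, map_sum, map_smul]

/-- The sum of the inclusions of the summands of the tensor product of the complexes of two
matroids, with the summands of bidegree `(i, j)` collected by the pair of subsets they belong to. -/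
def sumSubsPairs (i j : ℕ) :
    (⨁ P : SubsPair M M' i, ⨁ q : SumPair j,
        BiPower R (N ⧸ ρ.ρ (P.2.1.1 : Set α)) (N' ⧸ ρ'.ρ (P.2.2.1 : Set α)) q.1) →ₗ[R]
      TensorX (charComplex ρ) (charComplex ρ') i j :=
  DirectSum.toModule R _ _ fun P => DirectSum.toModule R (SumPair j) _ fun q =>
    tensorIncl (charComplex ρ) (charComplex ρ') P.1.2 q.2 ∘ₗ
      TensorProduct.map (chainIncl ρ P.2.1 q.1.1) (chainIncl ρ' P.2.2 q.1.2)

theorem sumSubsPairs_lof_lof_tmul (i j : ℕ) (P : SubsPair M M' i) (q : SumPair j)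
    (x : chainAt ρ P.2.1.1 q.1.1) (y : chainAt ρ' P.2.2.1 q.1.2) :
    sumSubsPairs ρ ρ' i j (DirectSum.lof R _ _ P (DirectSum.lof R (SumPair j) _ q (x ⊗ₜ y))) =
      tensorGen P.1.2 q.2 P.2.1 P.2.2 x y := by
  rw [sumSubsPairs, DirectSum.toModule_lof, DirectSum.toModule_lof]
  rfl

theorem sumSubsPairs_surjective (i j : ℕ) : Function.Surjective (sumSubsPairs ρ ρ' i j) := by
  have mkQ_eq_zero : (LinearMap.range (sumSubsPairs ρ ρ' i j)).mkQ = 0 :=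
    tensorGen_ext fun a a' b b' hi hj S S' x y => (Submodule.Quotient.mk_eq_zero _).2
      ⟨_, sumSubsPairs_lof_lof_tmul ρ ρ' i j ⟨⟨(a, a'), hi⟩, S, S'⟩ ⟨(b, b'), hj⟩ x y⟩
  rw [← LinearMap.range_eq_top, ← Submodule.ker_mkQ (LinearMap.range _), mkQ_eq_zero,
    LinearMap.ker_zero]

variable [IsPrincipalIdealRing R] [Module.Finite R N] [Module.Finite R N']
  (h : Disjoint M.E M'.E)

/-- The comparison map from the tensor product of the complexes of two matroids to the complex of
their direct sum. -/
def tensorToSum (i j : ℕ) :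
    TensorX (charComplex ρ) (charComplex ρ') i j →ₗ[R] chainGroup (ρ.directSum ρ' h) i j :=
  DirectSum.toModule R (Split i j) _ fun s => unionMap ρ ρ' h s.1.2 s.2.2

variable {i j a a' b b' : ℕ} (hi : a + a' = i) (hj : b + b' = j) (S : Subs M a) (S' : Subs M' a')
  (x : chainAt ρ S.1 b) (y : chainAt ρ' S'.1 b')

theorem tensorToSum_tensorGen :
    tensorToSum ρ ρ' h i j (tensorGen hi hj S S' x y) =
      shuffleSign R S.1 S'.1 • chainIncl (ρ.directSum ρ' h) (S.union h hi S') j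
        (unionWedge ρ ρ' h hi hj S S' (x ⊗ₜ y)) := by
  have tensorToSum_tensorIncl : tensorToSum ρ ρ' h i j (tensorGen hi hj S S' x y) =
      unionMap ρ ρ' h hi hj (chainIncl ρ S b x ⊗ₜ chainIncl ρ' S' b' y) := by
    rw [tensorToSum, tensorGen, tensorIncl, DirectSum.toModule_lof]
  rw [tensorToSum_tensorIncl, unionMap, TensorProduct.lift.tmul, DirectSum.toModule_lof,
    LinearMap.flip_apply, DirectSum.toModule_lof]
  rfl

theorem tensorToSum_insert_left (hi' : a + 1 + a' = i + 1) (e : outside M S.1) :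
    sign R S.1 e.1 • tensorToSum ρ ρ' h (i + 1) j
        (tensorGen hi' hj (S.insert e) S' (dAt ρ S e b x) y) =
      shuffleSign R S.1 S'.1 • sign R (S.union h hi S').1 e.1 •
        chainIncl (ρ.directSum ρ' h)
          ((S.union h hi S').insert ⟨e.1, mem_outside_union_left h hi S' e⟩) j
          (dAt (ρ.directSum ρ' h) (S.union h hi S') _ j
            (unionWedge ρ ρ' h hi hj S S' (x ⊗ₜ y))) := by
  rw [tensorToSum_tensorGen, unionWedge, wedgeAt_dAt_left, dAt_wedgeAt, smul_smul, smul_smul]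
  refine congrArg₂ (· • ·) (sign_mul_shuffleSign_insert_left R
    (disjoint_of_subset_ground h S.2.1 S'.2.1) (mem_outside.1 e.2).2) ?_
  exact chainIncl_wedgeAt_congr ρ ρ' h (Subtype.ext (Finset.insert_union e.1 S.1 S'.1)) _ _ _ _

theorem tensorToSum_insert_right (hi' : a + (a' + 1) = i + 1) (e : outside M' S'.1) :
    (-1 : R) ^ a • sign R S'.1 e.1 • tensorToSum ρ ρ' h (i + 1) j
        (tensorGen hi' hj S (S'.insert e) x (dAt ρ' S' e b' y)) =
      shuffleSign R S.1 S'.1 • sign R (S.union h hi S').1 e.1 •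
        chainIncl (ρ.directSum ρ' h)
          ((S.union h hi S').insert ⟨e.1, mem_outside_union_right h hi S e⟩) j
          (dAt (ρ.directSum ρ' h) (S.union h hi S') _ j
            (unionWedge ρ ρ' h hi hj S S' (x ⊗ₜ y))) := by
  have he : e.1 ∉ S.1 := fun heS =>
    Set.disjoint_left.1 h (S.2.1 heS) (mem_outside.1 e.2).1
  have signs := sign_mul_shuffleSign_insert_right R (disjoint_of_subset_ground h S.2.1 S'.2.1)
    he (mem_outside.1 e.2).2
  rw [S.2.2] at signs
  rw [tensorToSum_tensorGen, unionWedge, wedgeAt_dAt_right, dAt_wedgeAt, smul_smul, smul_smul,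
    smul_smul]
  refine congrArg₂ (· • ·) ((mul_assoc _ _ _).trans signs) ?_
  exact chainIncl_wedgeAt_congr ρ ρ' h (Subtype.ext (Finset.union_insert e.1 S.1 S'.1)) _ _ _ _

theorem tensorToSum_tensorD (i j : ℕ) (z : TensorX (charComplex ρ) (charComplex ρ') i j) :
    tensorToSum ρ ρ' h (i + 1) j (tensorD (charComplex ρ) (charComplex ρ') i j z) =
      chainD (ρ.directSum ρ' h) i j (tensorToSum ρ ρ' h i j z) := by
  have commute : tensorToSum ρ ρ' h (i + 1) j ∘ₗ tensorD (charComplex ρ) (charComplex ρ') i j =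
      chainD (ρ.directSum ρ' h) i j ∘ₗ tensorToSum ρ ρ' h i j := by
    refine tensorGen_ext fun a a' b b' hi hj S S' x y => ?_
    rw [LinearMap.comp_apply, LinearMap.comp_apply, tensorToSum_tensorGen, map_smul,
      chainD_chainIncl, tensorD_tensorGen, sum_outside_union h hi S S', map_add, map_smul, map_sum,
      map_sum, smul_add, Finset.smul_sum, Finset.smul_sum, Finset.smul_sum]
    simp only [map_smul]
    exact congrArg₂ (· + ·)
      (Finset.sum_congr rfl fun e _ => tensorToSum_insert_left ρ ρ' h hi hj S S' x y _ e)
      (Finset.sum_congr rfl fun e _ => tensorToSum_insert_right ρ ρ' h hi hj S S' x y _ e)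
  exact LinearMap.congr_fun commute z

theorem tensorToSum_comp_sumSubsPairs (i j : ℕ) :
    tensorToSum ρ ρ' h i j ∘ₗ sumSubsPairs ρ ρ' i j =
      DirectSum.toModule R _ _ fun P : SubsPair M M' i =>
        chainIncl (ρ.directSum ρ' h) (P.union h) j ∘ₗ signedWedgeSum ρ ρ' h P j := by
  refine DirectSum.linearMap_ext R fun P => DirectSum.linearMap_ext R fun q =>
    TensorProduct.ext' fun x y => ?_
  refine (congrArg (tensorToSum ρ ρ' h i j) (sumSubsPairs_lof_lof_tmul ρ ρ' i j P q x y)).trans <|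
    (tensorToSum_tensorGen ρ ρ' h P.1.2 q.2 P.2.1 P.2.2 x y).trans <|
    Eq.trans ?_ (DirectSum.toModule_lof R P _).symm
  refine (map_smul _ _ _).symm.trans ?_
  exact congrArg (chainIncl (ρ.directSum ρ' h) (P.union h) j)
    (signedWedgeSum_lof ρ ρ' h P j q (x ⊗ₜ y)).symm

theorem tensorToSum_bijective (i j : ℕ) : Function.Bijective (tensorToSum ρ ρ' h i j) := by
  have comp_bijective : Function.Bijective (tensorToSum ρ ρ' h i j ∘ₗ sumSubsPairs ρ ρ' i j) := by
    rw [tensorToSum_comp_sumSubsPairs]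
    exact toModule_lof_comp_bijective (SubsPair.union_bijective h)
      fun P => signedWedgeSum_bijective ρ ρ' h P j
  rw [LinearMap.coe_comp] at comp_bijective
  exact ⟨comp_bijective.1.of_comp_right (sumSubsPairs_surjective ρ ρ' i j),
    comp_bijective.2.of_comp⟩

/-- The complex of a direct sum is the tensor product of the complexes of the summands. -/
def directSumIso : Iso ((charComplex ρ).tensor (charComplex ρ'))
    (charComplex (ρ.directSum ρ' h)) where
  equiv i j := LinearEquiv.ofBijective _ (tensorToSum_bijective ρ ρ' h i j)
  comm := tensorToSum_tensorD ρ ρ' h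

end DirectSumComplex

end MatroidCohomology

end

open MatroidCohomology GradedComplex in
theorem proposition4p7 {R : Type*} [CommRing R] [IsDomain R] [IsPrincipalIdealRing R]
    {α : Type*} [LinearOrder α] (M M' : Matroid α) [M.Finite] [M'.Finite]
    (h : Disjoint M.E M'.E) {N N' : Type*}
    [AddCommGroup N] [Module R N] [Module.Finite R N]
    [AddCommGroup N'] [Module R N'] [Module.Finite R N']
    (ρ : QuasiRep R M N) (ρ' : QuasiRep R M' N') :
    ∃ Φ : Iso ((charComplex ρ).tensor (charComplex ρ')) (charComplex (ρ.directSum ρ' h)),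
      IsField R → ∀ i j : ℕ,
        ∃ κ : (⨁ s : Split i j, (charComplex ρ).cohomology s.1.1.1 s.2.1.1 ⊗[R]
              (charComplex ρ').cohomology s.1.1.2 s.2.1.2) ≃ₗ[R]
            (charComplex (ρ.directSum ρ' h)).cohomology i j,
          ∀ (s : Split i j) (x : (charComplex ρ).cocycles s.1.1.1 s.2.1.1)
            (y : (charComplex ρ').cocycles s.1.1.2 s.2.1.2),
            ∃ hz : Φ.equiv i j (tensorIncl (charComplex ρ) (charComplex ρ') s.1.2 s.2.2
                (x.1 ⊗ₜ[R] y.1)) ∈ (charComplex (ρ.directSum ρ' h)).cocycles i j,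
              κ (DirectSum.lof R (Split i j)
                  (fun s => (charComplex ρ).cohomology s.1.1.1 s.2.1.1 ⊗[R]
                    (charComplex ρ').cohomology s.1.1.2 s.2.1.2) s
                  ((charComplex ρ).cohomologyClass x ⊗ₜ[R]
                    (charComplex ρ').cohomologyClass y)) =
                (charComplex (ρ.directSum ρ' h)).cohomologyClass ⟨_, hz⟩ := by
  refine ⟨directSumIso ρ ρ' h, fun hR i j => ?_⟩
  have : IsSemisimpleRing R := by
    let _ := hR.toField
    infer_instance
  exact ⟨(directSumIso ρ ρ' h).kunnethEquiv i j, fun s x y =>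
    ⟨_, (directSumIso ρ ρ' h).kunnethEquiv_tensorIncl s.1.2 s.2.2 x y⟩⟩
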